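/- Let $\lambda,h,R>0$. Put $$K(x,y)=e^{-\frac{1}{8\lambda}(1-x^2)^2}\,e^{-\frac{\lambda}{2h^2}(x-y)^2}\,e^{-\frac{1}{8\lambda}(1-y^2)^2},\qquad c_\lambda=e^{-\frac1{4\lambda}},$$ let $\mathcal H_0:L^2([-R,R])\to L^2([-R,R])$, $\mathcal H_0[\phi](x)=\int_{-R}^RK(x,y)\phi(y)\,dy$, and for $d\ge1$ $$\mathcal H[\phi_1,\dots,\phi_d]=c_\lambda\int_{[-R,R]^d}K(0,x_1)K(x_1,x_2)\cdots K(x_{d-1},x_d)K(x_d,0)\,\phi_1(x_1)\cdots\phi_d(x_d)\,dx_1\cdots dx_d .$$ (1) $\mathcal H_0$ is compact, symmetric and positive semi-definite, and it has an eigendecomposition: there are continuous functions $u_1,u_2,\dots$ on $[-R,R]$ forming an orthonormal basis of $L^2([-R,R])$ and numbers $\lambda_1\ge\lambda_2\ge\dots\ge0$ with $\mathcal H_0u_j=\lambda_ju_j$. For any eigendecomposition as in (1) let $v_j=\sqrt{\lambda_j}\,u_j$ and $A_{j,\ell}^n=\int_{-R}^Rv_j(x)v_\ell(x)T_n(x/R)\,dx$,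 where $T_n$ is the $n$-th Chebyshev polynomial. For $\phi$ continuous on $[-R,R]$ let $\phi_{,n}=\frac{2}{\pi}\int_0^\pi\phi(R\cos\theta)\cos(n\theta)\,d\theta$ for $n\ge1$, and the same with $\frac1\pi$ in place of $\frac2\pi$ for $n=0$, be its Chebyshev coefficients; write $\phi_{i,n}$ for those of $\phi_i$. For $J\ge 1$, $N\ge0$ let $$\mathcal H^{(J,N)}[\phi_1,\dots,\phi_d]=c_\lambda\sum_{j_0,\dots,j_d=1}^{J}\ \sum_{n_1,\dots,n_d=0}^{N}v_{j_0}(0)\,A^{n_1}_{j_0,j_1}\cdots A^{n_d}_{j_{d-1},j_d}\,v_{j_d}(0)\,\phi_{1,n_1}\cdots\phi_{d,n_d}.$$ (2) For every $d\ge1$ and $\alpha>0$ there is a constant $M>0$, depending only on $\alpha,\lambda,h,d,R$, such that the following holds for every eigendecomposition as in (1). The sum $\mathrm{Tr}(\mathcal H_0)=\sum_j\lambda_j$ converges, and for all integers $J\ge1$, $p\ge1$, $N>p$ and all $\phi_1,\dots,\phi_d\in C^{p+1}([-R,R])$ one has $\phi_i(x)=\sum_{n\ge0}\phi_{i,n}T_n(x/R)$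 for $x\in[-R,R]$ and, with $$V_p=\max_i\Big\|\tfrac{d^{p+1}}{dt^{p+1}}\,\phi_i(Rt)\Big\|_{L^1([-1,1])},\qquad \varepsilon=\frac{2V_p}{\pi p(N-p)^p},\qquad \|\cdot\|_\infty=\|\cdot\|_{L^\infty([-R,R])},$$ $$\big|\mathcal H[\phi_1,\dots,\phi_d]-\mathcal H^{(J,N)}[\phi_1,\dots,\phi_d]\big|\le M e^{-\alpha J/2}\prod_{i=1}^d\|\phi_i\|_\infty+d\,c_\lambda\,\varepsilon\,\big(\max_i\|\phi_i\|_\infty+\varepsilon\big)^{d-1}K(0,0)\,\mathrm{Tr}(\mathcal H_0)^d .$$ If moreover $\max_i\|\phi_i\|_\infty\ge1$, then also $$\big|\mathcal H[\phi_1,\dots,\phi_d]-\mathcal H^{(J,N)}[\phi_1,\dots,\phi_d]\big|\le M e^{-\alpha J/2}\prod_{i=1}^d\|\phi_i\|_\infty+d\,c_\lambda\,\varepsilon\,(1+\varepsilon)^{d-1}K(0,0)\,\mathrm{Tr}(\mathcal H_0)^d\max_i\|\phi_i\|_\infty^{d-1}.$$ -/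

import Mathlib

open MeasureTheory Set
open scoped ENNReal

namespace GinzburgLandau

noncomputable section

/-- Lebesgue measure on the interval `[-R, R]`. -/
abbrev muI (R : ℝ) : Measure ℝ := volume.restrict (Icc (-R) R)

/-- The real Hilbert space `L²([-R, R])`. -/
abbrev L2I (R : ℝ) : Type := Lp ℝ 2 (muI R)

/-- The Ginzburg-Landau kernel
`K(x,y) = exp(-(1-x²)²/(8λ)) exp(-λ(x-y)²/(2h²)) exp(-(1-y²)²/(8λ))`. -/
def kernel (lam h x y : ℝ) : ℝ :=
  Real.exp (-(1 / (8 * lam)) * (1 - x ^ 2) ^ 2) *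
    Real.exp (-(lam / (2 * h ^ 2)) * (x - y) ^ 2) *
      Real.exp (-(1 / (8 * lam)) * (1 - y ^ 2) ^ 2)

theorem continuous_kernel (lam h : ℝ) :
    Continuous (fun z : ℝ × ℝ => kernel lam h z.1 z.2) := by
  unfold kernel
  fun_prop

theorem exists_kernel_bound (lam h R : ℝ) :
    ∃ C : ℝ, 0 ≤ C ∧ ∀ x ∈ Icc (-R) R, ∀ y ∈ Icc (-R) R, ‖kernel lam h x y‖ ≤ C := by
  obtain ⟨C, hC⟩ := ((isCompact_Icc (a := -R) (b := R)).prod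
    (isCompact_Icc (a := -R) (b := R))).exists_bound_of_continuousOn
      (continuous_kernel lam h).continuousOn
  exact ⟨max C 0, le_max_right _ _, fun x hx y hy => (hC (x, y) ⟨hx, hy⟩).trans (le_max_left _ _)⟩

theorem integrable_L2I {R : ℝ} (f : L2I R) : Integrable (fun y => f y) (muI R) :=
  (Lp.memLp f).integrable (by norm_num)

theorem integrable_kernel_mul (lam h : ℝ) {R : ℝ} (f : L2I R) {x : ℝ} (hx : x ∈ Icc (-R) R) :
    Integrable (fun y => kernel lam h x y * f y) (muI R) := by
  obtain ⟨C, _, hC⟩ := exists_kernel_bound lam h R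
  refine (integrable_L2I f).bdd_mul (c := C) ?_ ?_
  · exact ((continuous_kernel lam h).comp (Continuous.prodMk_right x)).aestronglyMeasurable
  · filter_upwards [ae_restrict_mem measurableSet_Icc] with y hy using hC x hx y hy

/-- `∫_{-R}^R |f| ≤ sqrt (2R) ‖f‖₂`, with the square root written as a power of the total mass. -/
theorem integral_norm_le {R : ℝ} (f : L2I R) :
    ∫ y, ‖f y‖ ∂(muI R) ≤ ‖f‖ * ((muI R) univ ^ (1 / 2 : ℝ)).toReal := by
  have h1 := eLpNorm_le_eLpNorm_mul_rpow_measure_univ (μ := muI R) (f := fun y => f y)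
    (p := 1) (q := 2) (by norm_num) (Lp.memLp f).1
  have h2 : (1 / (1 : ℝ≥0∞).toReal - 1 / (2 : ℝ≥0∞).toReal) = (1 / 2 : ℝ) := by norm_num
  rw [h2] at h1
  rw [integral_norm_eq_lintegral_enorm (Lp.memLp f).1, ← eLpNorm_one_eq_lintegral_enorm,
    Lp.norm_def, ← ENNReal.toReal_mul]
  refine ENNReal.toReal_mono ?_ h1
  exact ENNReal.mul_ne_top (Lp.eLpNorm_ne_top f)
    (ENNReal.rpow_ne_top_of_nonneg (by norm_num) (measure_ne_top _ _))

theorem norm_integral_kernel_le {lam h R C : ℝ}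
    (hC : ∀ x ∈ Icc (-R) R, ∀ y ∈ Icc (-R) R, ‖kernel lam h x y‖ ≤ C) (f : L2I R) {x : ℝ}
    (hx : x ∈ Icc (-R) R) :
    ‖∫ y, kernel lam h x y * f y ∂(muI R)‖ ≤ C * ∫ y, ‖f y‖ ∂(muI R) := by
  rw [← integral_const_mul]
  refine norm_integral_le_of_norm_le ((integrable_L2I f).norm.const_mul C) ?_
  filter_upwards [ae_restrict_mem measurableSet_Icc] with y hy
  rw [norm_mul]
  exact mul_le_mul_of_nonneg_right (hC x hx y hy) (norm_nonneg _)

theorem memLp_integral_kernel (lam h : ℝ) {R : ℝ} (f : L2I R) :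
    MemLp (fun x => ∫ y, kernel lam h x y * f y ∂(muI R)) 2 (muI R) := by
  obtain ⟨C, _, hC⟩ := exists_kernel_bound lam h R
  refine MemLp.of_bound ?_ (C * ∫ y, ‖f y‖ ∂(muI R)) ?_
  · refine StronglyMeasurable.aestronglyMeasurable ?_
    exact StronglyMeasurable.integral_prod_right'
      (f := fun z : ℝ × ℝ => kernel lam h z.1 z.2 * f z.2)
      ((continuous_kernel lam h).stronglyMeasurable.mul
        ((Lp.stronglyMeasurable f).comp_measurable measurable_snd))
  · filter_upwards [ae_restrict_mem measurableSet_Icc] with x hx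
    exact norm_integral_kernel_le hC f hx

/-- The integral operator `H₀ f (x) = ∫_{-R}^R K(x,y) f(y) dy` on `L²([-R, R])`. -/
def opH0 (lam h R : ℝ) : L2I R →L[ℝ] L2I R :=
  LinearMap.mkContinuousOfExistsBound
    { toFun := fun f => (memLp_integral_kernel lam h f).toLp _
      map_add' := by
        intro f g
        rw [← MemLp.toLp_add, MemLp.toLp_eq_toLp_iff]
        filter_upwards [ae_restrict_mem measurableSet_Icc] with x hx
        rw [Pi.add_apply, ← integral_add (integrable_kernel_mul lam h f hx)
          (integrable_kernel_mul lam h g hx)]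
        refine integral_congr_ae ?_
        filter_upwards [Lp.coeFn_add f g] with y hy
        rw [hy, Pi.add_apply, mul_add]
      map_smul' := by
        intro c f
        rw [RingHom.id_apply, ← MemLp.toLp_const_smul, MemLp.toLp_eq_toLp_iff]
        refine Filter.Eventually.of_forall fun x => ?_
        rw [Pi.smul_apply, smul_eq_mul, ← integral_const_mul]
        refine integral_congr_ae ?_
        filter_upwards [Lp.coeFn_smul c f] with y hy
        rw [hy, Pi.smul_apply, smul_eq_mul]
        ring }
    (by
      obtain ⟨C, hC0, hC⟩ := exists_kernel_bound lam h R
      set m : ℝ := ((muI R) univ ^ (1 / 2 : ℝ)).toReal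
      refine ⟨m * (C * m), fun f => ?_⟩
      have hb : ∀ᵐ x ∂(muI R), ‖((memLp_integral_kernel lam h f).toLp _ : L2I R) x‖ ≤
          C * (‖f‖ * m) := by
        filter_upwards [ae_restrict_mem measurableSet_Icc,
          (memLp_integral_kernel lam h f).coeFn_toLp] with x hx hx'
        rw [hx']
        exact (norm_integral_kernel_le hC f hx).trans
          (mul_le_mul_of_nonneg_left (integral_norm_le f) hC0)
      have hCm : 0 ≤ C * (‖f‖ * m) :=
        mul_nonneg hC0 (mul_nonneg (norm_nonneg _) ENNReal.toReal_nonneg)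
      have hle := Lp.norm_le_of_ae_bound hCm hb
      refine hle.trans (le_of_eq ?_)
      have hm : m = ((measureUnivNNReal (muI R) : ℝ) ^ ((2 : ℝ≥0∞).toReal⁻¹ : ℝ)) := by
        have h2 : ((2 : ℝ≥0∞).toReal⁻¹ : ℝ) = 1 / 2 := by norm_num
        rw [h2]
        exact (ENNReal.toReal_rpow _ _).symm
      rw [← hm]
      ring)

/-- `(ev j)`, `(u j)` (indexed from `0`) is an eigendecomposition of `H₀`: the functions `u j` are
continuous on `[-R, R]`, their classes form an orthonormal (Hilbert) basis of `L²([-R, R])`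
consisting of eigenvectors of `H₀`, and the eigenvalues are nonnegative and nonincreasing.
Continuity selects the representative that is evaluated at the point `0`. -/
structure IsEigendecomposition (lam h R : ℝ) (ev : ℕ → ℝ) (u : ℕ → ℝ → ℝ) : Prop where
  continuousOn : ∀ j, ContinuousOn (u j) (Icc (-R) R)
  nonneg : ∀ j, 0 ≤ ev j
  antitone : Antitone ev
  basis : ∃ b : HilbertBasis ℕ ℝ (L2I R),
    ∀ j, (b j : ℝ → ℝ) =ᵐ[muI R] u j ∧ opH0 lam h R (b j) = ev j • b j

/-- The normalisation `c_λ = exp(-1/(4λ))`. -/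
def cLam (lam : ℝ) : ℝ := Real.exp (-(1 / (4 * lam)))

/-- The chain `(x_0, x_1, …, x_d, x_{d+1}) = (0, x_1, …, x_d, 0)`. -/
def chain {d : ℕ} (x : Fin d → ℝ) : Fin (d + 2) → ℝ :=
  Fin.cons 0 (Fin.snoc x 0 : Fin (d + 1) → ℝ)

/-- The functional `H[φ_1, …, φ_d]`. -/
def funcH (lam h R : ℝ) {d : ℕ} (phi : Fin d → ℝ → ℝ) : ℝ :=
  cLam lam * ∫ x in univ.pi (fun _ : Fin d => Icc (-R) R),
    (∏ k : Fin (d + 1), kernel lam h (chain x k.castSucc) (chain x k.succ)) *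
      ∏ i : Fin d, phi i (x i)

/-- The rescaled eigenfunctions `v_j = sqrt(λ_j) u_j`. -/
def vFun (ev : ℕ → ℝ) (u : ℕ → ℝ → ℝ) (j : ℕ) (x : ℝ) : ℝ := Real.sqrt (ev j) * u j x

/-- `A_{j,l}[φ] = ∫_{-R}^R v_j v_l φ`. -/
def coefA (R : ℝ) (ev : ℕ → ℝ) (u : ℕ → ℝ → ℝ) (j l : ℕ) (f : ℝ → ℝ) : ℝ :=
  ∫ x in (-R)..R, vFun ev u j x * vFun ev u l x * f x

/-- The scaled Chebyshev polynomial `T_n(x/R)`. -/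
def chebT (R : ℝ) (n : ℕ) (x : ℝ) : ℝ := (Polynomial.Chebyshev.T ℝ n).eval (x / R)

/-- The `n`-th coefficient of the expansion of `f` in the scaled Chebyshev polynomials on
`[-R, R]`: `(2/π) ∫_0^π f(R cos θ) cos(nθ) dθ`, with `1/π` in place of `2/π` for `n = 0`. -/
def chebCoeff (R : ℝ) (f : ℝ → ℝ) (n : ℕ) : ℝ :=
  (if n = 0 then 1 else 2) / Real.pi *
    ∫ θ in (0 : ℝ)..Real.pi, f (R * Real.cos θ) * Real.cos (n * θ)

/-- `H^{(J,N)}[φ_1, …, φ_d]`: the eigenvalue sums run over the first `J` eigenvalues and the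
Chebyshev sums over `0 ≤ n_i ≤ N`. -/
def funcHTrunc (lam R : ℝ) (ev : ℕ → ℝ) (u : ℕ → ℝ → ℝ) (J N : ℕ) {d : ℕ}
    (phi : Fin d → ℝ → ℝ) : ℝ :=
  cLam lam * ∑ j : Fin (d + 1) → Fin J, ∑ n : Fin d → Fin (N + 1),
    vFun ev u (j 0) 0 *
      (∏ i : Fin d, coefA R ev u (j i.castSucc) (j i.succ) (chebT R (n i))) *
        vFun ev u (j (Fin.last d)) 0 * ∏ i : Fin d, chebCoeff R (phi i) (n i)

/-- The norm of `L^∞([-R, R])`. -/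
def supNorm (R : ℝ) (f : ℝ → ℝ) : ℝ := lpNorm f ∞ (muI R)

/-- `max_i ‖φ_i‖_∞`. -/
def maxSupNorm (R : ℝ) {d : ℕ} (phi : Fin d → ℝ → ℝ) : ℝ := ⨆ i, supNorm R (phi i)

/-- `V_p = max_i ‖d^{p+1}/dt^{p+1} φ_i(R t)‖_{L¹([-1,1])}`. -/
def Vp (R : ℝ) (p : ℕ) {d : ℕ} (phi : Fin d → ℝ → ℝ) : ℝ :=
  ⨆ i, ∫ t in (-1 : ℝ)..1,
    |iteratedDerivWithin (p + 1) (fun s => phi i (R * s)) (Icc (-1) 1) t|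

/-- `2 V_p / (π p (N-p)^p)`. -/
def chebTail (R : ℝ) (p N : ℕ) {d : ℕ} (phi : Fin d → ℝ → ℝ) : ℝ :=
  2 * Vp R p phi / (Real.pi * p * ((N : ℝ) - p) ^ p)

end

end GinzburgLandau

namespace GinzburgLandau

noncomputable section

open InnerProductSpace Filter Topology

/-! ### Operators of the form `∑ gₙ ⊗ gₙ` on a Hilbert space. -/

section HilbertSpace

variable {E : Type*} [NormedAddCommGroup E] [InnerProductSpace ℝ E]

/-! Expanding `(x - y)²` gives `K(x,y) = w(x) w(y) exp(λxy/h²)`, and the power series of the last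
factor gives `K(x,y) = ∑ gₙ(x) gₙ(y)` with `gₙ² ≤ sⁿ/n!` on `[-R, R]`, where `s = λR²/h²`. Hence `H₀
= ∑ gₙ ⊗ gₙ` in operator norm (`hasSum_opH0`), which yields compactness and positivity. By
Weierstrass the `gₙ` are total, so `H₀` is injective and the spectral theorem provides a basis with
positive eigenvalues (`exists_hilbertBasis_antitone`).

A min-max argument bounds the eigenvalue `ev J` by `∑_{n ≥ J} ‖gₙ‖²` (`eigenvalue_le_tsum_norm_sq`),
hence by an explicit constant times `exp(-αJ)` for any `α > 0`. The full Mercer theorem is not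
needed: the diagonal inequality `∑ ev j * u j x ^ 2 ≤ K(x,x)` (`sum_eigenvalue_mul_sq_le`) controls
the truncated kernel `K_J` and gives `∫ |K(x,y) - K_J(x,y)| dy ≤ sqrt(2R ev J)`.

On the Chebyshev side, repeated integration by parts bounds the coefficients by `V / (k (k-1) ⋯
(k-p))`, up to the factor `2/π`, and the tail of these bounds telescopes to the stated `ε`.

Finally `H^{(J,N)}` is the chain integral defining `H` with `K_J` in place of `K` and Chebyshev
partial sums in place of the `φ_i` (`funcHTrunc_eq_integral`). Replacing the kernel first costs the
`exp(-αJ/2)` term. Replacing the functions afterwards, against `K_J`, costs the `ε` term: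
Cauchy-Schwarz splits `|K_J(x,y)|` into `sqrt K_J(x,x) sqrt K_J(y,y)`, so the chain integral factors
into `K_J(0,0)` and powers of `∫ K_J(x,x) dx`, which is at most the trace. -/

theorem hasSum_inner_sq {g : ℕ → E} {T : E →L[ℝ] E}
    (hT : HasSum (fun n => rankOne ℝ (g n) (g n)) T) (f : E) :
    HasSum (fun n => inner ℝ (g n) f ^ 2) (inner ℝ (T f) f) := by
  have h := (hT.mapL (ContinuousLinearMap.apply ℝ E f)).mapL (innerSL ℝ f)
  simpa [inner_smul_right, real_inner_comm, sq] using h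

theorem isPositive_of_hasSum_rankOne {g : ℕ → E} {T : E →L[ℝ] E}
    (hT : HasSum (fun n => rankOne ℝ (g n) (g n)) T) : T.IsPositive := by
  constructor
  · intro x y
    have h1 := (hT.mapL (ContinuousLinearMap.apply ℝ E x)).mapL (innerSL ℝ y)
    have h2 := (hT.mapL (ContinuousLinearMap.apply ℝ E y)).mapL (innerSL ℝ x)
    have h3 := h1.unique (by simpa [inner_smul_right, real_inner_comm, mul_comm] using h2)
    simpa [real_inner_comm] using h3
  · intro x
    have h := hasSum_inner_sq hT x
    exact h.nonneg fun n => sq_nonneg _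

/-- The partial sums have finite rank and converge in operator norm. -/
theorem isCompactOperator_of_hasSum_rankOne [CompleteSpace E] {g : ℕ → E} {T : E →L[ℝ] E}
    (hT : HasSum (fun n => rankOne ℝ (g n) (g n)) T) : IsCompactOperator T := by
  refine isCompactOperator_of_tendsto hT.tendsto_sum_nat (Filter.Eventually.of_forall fun N => ?_)
  induction N with
  | zero => simpa using isCompactOperator_zero
  | succ N ih =>
    rw [Finset.sum_range_succ]
    have hid : IsCompactOperator (id : ℝ → ℝ) :=
      (isCompactOperator_id_iff_finiteDimensional (𝕜 := ℝ)).2 inferInstance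
    exact ih.add ((hid.clm_comp (ContinuousLinearMap.toSpanSingleton ℝ (g N))).comp_clm
      (innerSL ℝ (g N)))

/-- Eigenvalues of `∑ gₙ ⊗ gₙ` are bounded by the tails of `∑ ‖gₙ‖²`. -/
theorem eigenvalue_le_tsum_norm_sq {g : ℕ → E} {T : E →L[ℝ] E}
    (hT : HasSum (fun n => rankOne ℝ (g n) (g n)) T) (hg : Summable fun n => ‖g n‖ ^ 2)
    {b : ℕ → E} (hb : Orthonormal ℝ b) {ev : ℕ → ℝ} (hev : ∀ j, T (b j) = ev j • b j)
    (hanti : Antitone ev) (J : ℕ) : ev J ≤ ∑' n, ‖g (n + J)‖ ^ 2 := by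
  classical
  -- `J + 1` unknowns against `J` equations: some nonzero `f` in the span of `b 0, …, b J` is
  -- orthogonal to `g 0, …, g (J-1)`. Its Rayleigh quotient is at least `ev J`, and only the terms
  -- `n ≥ J` contribute to it.
  let L : (Fin (J + 1) → ℝ) →ₗ[ℝ] (Fin J → ℝ) :=
    LinearMap.pi fun n => (innerₛₗ ℝ (g n)) ∘ₗ
      (∑ j : Fin (J + 1), (LinearMap.proj j).smulRight (b j))
  have hker : LinearMap.ker L ≠ ⊥ := LinearMap.ker_ne_bot_of_finrank_lt (by simp)
  obtain ⟨c, hc, hc0⟩ := Submodule.exists_mem_ne_zero_of_ne_bot hker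
  set f : E := ∑ j : Fin (J + 1), c j • b j with hf
  have hfg : ∀ n < J, inner ℝ (g n) f = 0 := by
    intro n hn
    have := congrFun (LinearMap.mem_ker.1 hc) ⟨n, hn⟩
    simpa [L, hf, LinearMap.sum_apply] using this
  have hbf : Orthonormal ℝ (fun j : Fin (J + 1) => b j) :=
    hb.comp _ Fin.val_injective
  have hnorm : ‖f‖ ^ 2 = ∑ j, c j ^ 2 := by
    rw [← real_inner_self_eq_norm_sq, hf, hbf.inner_sum]
    simp [sq]
  have hpos : 0 < ‖f‖ ^ 2 := by
    rw [hnorm]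
    obtain ⟨i, hi⟩ := Function.ne_iff.1 hc0
    exact Finset.sum_pos' (fun _ _ => sq_nonneg _) ⟨i, Finset.mem_univ _, by
      have : c i ≠ 0 := hi
      positivity⟩
  have hTf : inner ℝ (T f) f = ∑ j : Fin (J + 1), ev j * c j ^ 2 := by
    have : T f = ∑ j : Fin (J + 1), (c j * ev j) • b j := by
      simp [hf, map_sum, hev, smul_smul]
    rw [this, hf, hbf.inner_sum]
    refine Finset.sum_congr rfl fun j _ => ?_
    simp; ring
  have hlow : ev J * ‖f‖ ^ 2 ≤ inner ℝ (T f) f := by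
    rw [hTf, hnorm, Finset.mul_sum]
    refine Finset.sum_le_sum fun j _ => ?_
    exact mul_le_mul_of_nonneg_right (hanti (Nat.lt_succ_iff.1 j.2)) (sq_nonneg _)
  have hs := hasSum_inner_sq hT f
  have hup : inner ℝ (T f) f ≤ (∑' n, ‖g (n + J)‖ ^ 2) * ‖f‖ ^ 2 := by
    rw [← hs.tsum_eq, ← hs.summable.sum_add_tsum_nat_add J, Finset.sum_eq_zero, zero_add,
      ← tsum_mul_right]
    · refine Summable.tsum_le_tsum (fun n => ?_) ((summable_nat_add_iff J).2 hs.summable)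
        (((summable_nat_add_iff J).2 hg).mul_right _)
      rw [← mul_pow]
      exact sq_le_sq' (by linarith [neg_abs_le (inner ℝ (g (n + J)) f),
        abs_real_inner_le_norm (g (n + J)) f]) (real_inner_le_norm _ _)
    · intro n hn
      rw [hfg n (Finset.mem_range.1 hn)]; simp
  exact le_of_mul_le_mul_right (hlow.trans hup) hpos

theorem eigenvalue_eq_inner {T : E →L[ℝ] E} {ι : Type*} {b : ι → E} (hb : Orthonormal ℝ b)
    {ev : ι → ℝ} (hev : ∀ j, T (b j) = ev j • b j) (j : ι) :
    inner ℝ (T (b j)) (b j) = ev j := by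
  rw [hev, inner_smul_left, real_inner_self_eq_norm_sq, hb.1 j]; simp

/-- Each eigenvalue is `∑ₙ ⟨gₙ, b j⟩²`; exchanging the sums and applying Bessel's inequality to each
`gₙ` bounds every finite sum by `∑ ‖gₙ‖²`. The index type is arbitrary because the lemma is also
applied before the eigenvectors have been enumerated. -/
theorem summable_eigenvalues {g : ℕ → E} {T : E →L[ℝ] E}
    (hT : HasSum (fun n => rankOne ℝ (g n) (g n)) T) (hg : Summable fun n => ‖g n‖ ^ 2)
    {ι : Type*} {b : ι → E} (hb : Orthonormal ℝ b) {ev : ι → ℝ}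
    (hev : ∀ j, T (b j) = ev j • b j) : Summable ev := by
  have hs : ∀ j, HasSum (fun n => inner ℝ (g n) (b j) ^ 2) (ev j) := fun j => by
    simpa only [eigenvalue_eq_inner hb hev j] using hasSum_inner_sq hT (b j)
  refine summable_of_sum_le (c := ∑' n, ‖g n‖ ^ 2)
    (fun j => (hs j).nonneg fun n => sq_nonneg _) fun s => ?_
  have h1 := hasSum_sum (s := s) fun j _ => hs j
  refine hasSum_le (fun n => ?_) h1 hg.hasSum
  have := hb.sum_inner_products_le (x := g n) (s := s)
  simpa [real_inner_comm] using this

/-- A positive function on an infinite type with finite superlevel sets can be enumerated in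
nonincreasing order. -/
theorem exists_equiv_nat_antitone {ι : Type*} [Infinite ι] {e : ι → ℝ} (hpos : ∀ i, 0 < e i)
    (hfin : ∀ ε > 0, {i | ε ≤ e i}.Finite) : ∃ σ : ℕ ≃ ι, Antitone (e ∘ σ) := by
  classical
  have hcount : Countable ι := by
    have : (⋃ n : ℕ, {i | 1 / ((n : ℝ) + 1) ≤ e i}) = univ := by
      refine eq_univ_of_forall fun i => mem_iUnion.2 ?_
      obtain ⟨n, hn⟩ := exists_nat_one_div_lt (hpos i)
      exact ⟨n, hn.le⟩
    rw [← countable_univ_iff, ← this]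
    exact countable_iUnion fun n => (hfin _ (by positivity)).countable
  obtain ⟨c, hc⟩ := hcount.exists_injective_nat
  -- Ties between equal values are broken by the injection `c`, so that `key` is a strict ranking
  -- with finitely many predecessors of each element; `r` counts them.
  let key : ι → ℝ ×ₗ ℕ := fun i => toLex (-e i, c i)
  have hkey : Function.Injective key := fun i j hij => by
    have := congrArg (fun z => (ofLex z).2) hij
    exact hc this
  have hle : ∀ i j, key j ≤ key i → e i ≤ e j := fun i j hij => by
    rcases Prod.Lex.toLex_le_toLex.1 hij with h | h
    · exact (neg_lt_neg_iff.1 h).le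
    · exact (neg_injective h.1).ge
  have hfinI : ∀ i, {j | key j < key i}.Finite := fun i =>
    (hfin (e i) (hpos i)).subset fun j hj => hle i j hj.le
  let r : ι → ℕ := fun i => {j | key j < key i}.ncard
  have hr : ∀ i j, key i < key j → r i < r j := fun i j hij =>
    ncard_lt_ncard ⟨fun k hk => lt_trans hk hij, fun h => lt_irrefl (key i) (h hij)⟩
      (hfinI j)
  have hrinj : Function.Injective r := fun i j hij => by
    rcases lt_trichotomy (key i) (key j) with h | h | h
    · exact absurd hij (hr _ _ h).ne
    · exact hkey h
    · exact absurd hij (hr _ _ h).ne'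
  -- The `r i` predecessors of `i` are mapped injectively into `Iio (r i)`, hence onto it. So the
  -- range of `r` is an initial segment of `ℕ`, and being infinite it is everything.
  have hlower : ∀ i, ∀ m < r i, m ∈ range r := by
    intro i m hm
    have himg : r '' {j | key j < key i} = Iio (r i) := by
      refine eq_of_subset_of_ncard_le ?_ ?_ (finite_Iio _)
      · rintro _ ⟨j, hj, rfl⟩
        exact hr _ _ hj
      · rw [ncard_image_of_injective _ hrinj]
        rw [← Finset.coe_Iio, ncard_coe_finset, Nat.card_Iio]
    have : m ∈ r '' {j | key j < key i} := himg ▸ hm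
    exact image_subset_range _ _ this
  have hsurj : Function.Surjective r := by
    intro m
    obtain ⟨_, ⟨i, rfl⟩, hi⟩ := (infinite_range_of_injective hrinj).exists_gt m
    exact hlower i m hi
  refine ⟨(Equiv.ofBijective r ⟨hrinj, hsurj⟩).symm, fun m n hmn => hle _ _ ?_⟩
  by_contra! h
  have := hr _ _ h
  rw [← Equiv.ofBijective_apply r (hf := ⟨hrinj, hsurj⟩),
    ← Equiv.ofBijective_apply r (hf := ⟨hrinj, hsurj⟩), Equiv.apply_symm_apply,
    Equiv.apply_symm_apply] at this
  omega

/-- An injective operator `∑ gₙ ⊗ gₙ` on an infinite-dimensional Hilbert space has a Hilbert basis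
of eigenvectors with positive nonincreasing eigenvalues. -/
theorem exists_hilbertBasis_antitone [CompleteSpace E] {g : ℕ → E} {T : E →L[ℝ] E}
    (hT : HasSum (fun n => rankOne ℝ (g n) (g n)) T) (hg : Summable fun n => ‖g n‖ ^ 2)
    (htotal : ∀ f : E, (∀ n, inner ℝ (g n) f = 0) → f = 0) (hE : ¬ FiniteDimensional ℝ E) :
    ∃ (b : HilbertBasis ℕ ℝ E) (ev : ℕ → ℝ), Antitone ev ∧ (∀ j, 0 < ev j) ∧
      ∀ j, T (b j) = ev j • b j := by
  have hsymm := (isPositive_of_hasSum_rankOne hT).isSymmetric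
  have hcpt := isCompactOperator_of_hasSum_rankOne hT
  let V : ℝ → Submodule ℝ E := fun μ => Module.End.eigenspace (T : E →ₗ[ℝ] E) μ
  have hVclosed : ∀ μ, IsClosed (V μ : Set E) := fun μ => by
    have : (V μ : Set E) = {x | T x = μ • x} := by
      ext x; simp [V]
    rw [this]
    exact isClosed_eq T.continuous (continuous_const_smul μ)
  have : ∀ μ, CompleteSpace (V μ) := fun μ => (hVclosed μ).completeSpace_coe
  choose w B hB using fun μ => exists_hilbertBasis ℝ (V μ)
  let v : (Σ μ, w μ) → E := fun a => (B a.1 a.2 : E)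
  have hv : Orthonormal ℝ v :=
    hsymm.orthogonalFamily_eigenspaces.orthonormal_sigma_orthonormal fun μ => (B μ).orthonormal
  have hTv : ∀ a, T (v a) = a.1 • v a := fun a =>
    Module.End.mem_eigenspace_iff.1 (B a.1 a.2).2
  -- A vector orthogonal to the basis of every eigenspace is orthogonal to all eigenspaces, and for
  -- a compact symmetric operator these have dense span.
  have hbot : (Submodule.span ℝ (range v))ᗮ = ⊥ := by
    rw [eq_bot_iff,
      ← ContinuousLinearMap.orthogonalComplement_iSup_eigenspaces_eq_bot hcpt hsymm]
    intro f hf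
    have hfV : ∀ μ, V μ ≤ (Submodule.span ℝ {f})ᗮ := by
      intro μ x hx
      rw [Submodule.mem_orthogonal_singleton_iff_inner_right]
      have h1 := (((B μ).hasSum_repr ⟨x, hx⟩).mapL (V μ).subtypeL).mapL (innerSL ℝ f)
      refine h1.unique ?_
      have h2 : ∀ i, inner ℝ f (B μ i : E) = 0 := fun i =>
        (Submodule.mem_orthogonal' _ _).1 hf _ (Submodule.subset_span ⟨⟨μ, i⟩, rfl⟩)
      simp [h2]
    rw [Submodule.mem_orthogonal']
    intro x hx
    exact Submodule.mem_orthogonal_singleton_iff_inner_right.1 (iSup_le hfV hx)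
  let b0 := HilbertBasis.mkOfOrthogonalEqBot hv hbot
  -- A zero eigenvalue would force `∑ₙ ⟨gₙ, v a⟩² = 0`, contradicting totality of the `gₙ`.
  have hpos : ∀ a : (Σ μ, w μ), 0 < a.1 := by
    intro a
    have h1 := hasSum_inner_sq hT (v a)
    rw [eigenvalue_eq_inner hv hTv a] at h1
    refine (h1.nonneg fun _ => sq_nonneg _).lt_of_ne fun h0 => hv.ne_zero a (htotal _ fun n => ?_)
    rw [← h0] at h1
    have := (hasSum_zero_iff_of_nonneg fun _ => sq_nonneg _).1 h1
    simpa using congrFun this n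
  have hsum : Summable fun a : (Σ μ, w μ) => a.1 := summable_eigenvalues hT hg hv hTv
  have hinf : Infinite (Σ μ, w μ) := by
    by_contra hfin
    rw [not_infinite_iff_finite] at hfin
    have := Fintype.ofFinite (Σ μ, w μ)
    exact hE b0.toOrthonormalBasis.toBasis.finiteDimensional_of_finite
  obtain ⟨σ, hσ⟩ := exists_equiv_nat_antitone hpos fun ε hε => by
    have := hsum.tendsto_cofinite_zero.eventually (gt_mem_nhds hε)
    simpa [Filter.eventually_cofinite] using this
  have hvσ : Orthonormal ℝ (v ∘ σ) := hv.comp _ σ.injective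
  refine ⟨HilbertBasis.mkOfOrthogonalEqBot hvσ ?_, _, hσ, fun j => hpos _, fun j => ?_⟩
  · rw [σ.surjective.range_comp]; exact hbot
  · simpa using hTv (σ j)

end HilbertSpace

/-! ### Basic facts about `L²([-R, R])`. -/

theorem memLp_of_continuousOn {R : ℝ} {f : ℝ → ℝ} (hf : ContinuousOn f (Icc (-R) R)) :
    MemLp f 2 (muI R) := by
  obtain ⟨C, hC⟩ := isCompact_Icc.exists_bound_of_continuousOn hf
  refine MemLp.of_bound (hf.aestronglyMeasurable measurableSet_Icc) C ?_
  filter_upwards [ae_restrict_mem measurableSet_Icc] with x hx using hC x hx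

theorem inner_toLp {R : ℝ} {f : ℝ → ℝ} (hf : MemLp f 2 (muI R)) (k : L2I R) :
    inner ℝ (hf.toLp f) k = ∫ y, f y * k y ∂(muI R) := by
  rw [L2.inner_def]
  refine integral_congr_ae ?_
  filter_upwards [hf.coeFn_toLp] with y hy
  simp [hy, mul_comm]

theorem muI_real_univ {R : ℝ} (hR : 0 < R) : (muI R).real univ = 2 * R := by
  simp [Measure.real, Real.volume_Icc, hR.le]
  ring

theorem norm_toLp_sq_le {R : ℝ} (hR : 0 < R) {f : ℝ → ℝ} (hf : MemLp f 2 (muI R)) {C : ℝ}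
    (hC : ∀ x ∈ Icc (-R) R, f x ^ 2 ≤ C) : ‖hf.toLp f‖ ^ 2 ≤ 2 * R * C := by
  rw [← real_inner_self_eq_norm_sq, inner_toLp]
  have h1 : ∫ y, f y * (hf.toLp f) y ∂(muI R) = ∫ y, f y ^ 2 ∂(muI R) := by
    refine integral_congr_ae ?_
    filter_upwards [hf.coeFn_toLp] with y hy
    rw [hy, sq]
  rw [h1]
  have h2 : ∫ y, f y ^ 2 ∂(muI R) ≤ ∫ _, C ∂(muI R) := by
    refine integral_mono_ae hf.integrable_sq (integrable_const _) ?_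
    filter_upwards [ae_restrict_mem measurableSet_Icc] with x hx using hC x hx
  rwa [integral_const, muI_real_univ hR, smul_eq_mul] at h2

/-- Polynomials embed: two that agree a.e. on the interval agree on all of it by continuity, hence
at infinitely many points. -/
theorem not_finiteDimensional_L2I {R : ℝ} (hR : 0 < R) : ¬ FiniteDimensional ℝ (L2I R) := by
  intro hfin
  have hmem : ∀ p : Polynomial ℝ, MemLp (fun x => p.eval x) 2 (muI R) := fun p =>
    memLp_of_continuousOn p.continuous.continuousOn
  let L : Polynomial ℝ →ₗ[ℝ] L2I R :=
    { toFun := fun p => (hmem p).toLp _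
      map_add' := fun p q => by
        rw [← MemLp.toLp_add]
        congr 1; ext x; simp
      map_smul' := fun c p => by
        rw [RingHom.id_apply, ← MemLp.toLp_const_smul]
        congr 1; ext x; simp }
  have hL : Function.Injective L := by
    intro p q hpq
    have h1 : (fun x => p.eval x) =ᵐ[muI R] fun x => q.eval x :=
      (MemLp.toLp_eq_toLp_iff (hmem p) (hmem q)).1 hpq
    have h2 := Measure.eqOn_Icc_of_ae_eq (volume : Measure ℝ) (by linarith : -R ≠ R) h1
      p.continuous.continuousOn q.continuous.continuousOn
    exact Polynomial.eq_of_infinite_eval_eq p q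
      ((Icc_infinite (by linarith : -R < R)).mono fun x hx => h2 hx)
  exact Polynomial.not_finite (Module.Finite.of_injective L hL)

/-! ### Rank-one expansion of the kernel and of `H₀`. -/

/-- The terms of the expansion `K(x,y) = ∑ₙ gₙ(x) gₙ(y)` coming from the power series of
`exp(λxy/h²)`. -/
def feature (lam h : ℝ) (n : ℕ) (x : ℝ) : ℝ :=
  Real.exp (-(1 / (8 * lam)) * (1 - x ^ 2) ^ 2) * Real.exp (-(lam / (2 * h ^ 2)) * x ^ 2) *
    (Real.sqrt ((lam / h ^ 2) ^ n / n.factorial) * x ^ n)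

theorem continuous_feature (lam h : ℝ) (n : ℕ) : Continuous (feature lam h n) := by
  unfold feature; fun_prop

theorem memLp_feature (lam h R : ℝ) (n : ℕ) : MemLp (feature lam h n) 2 (muI R) :=
  memLp_of_continuousOn (continuous_feature lam h n).continuousOn

def featureLp (lam h R : ℝ) (n : ℕ) : L2I R := (memLp_feature lam h R n).toLp _

section

variable {lam h R : ℝ} (hlam : 0 < lam)
include hlam

theorem feature_mul_feature (n : ℕ) (x y : ℝ) :
    feature lam h n x * feature lam h n y =
      Real.exp (-(1 / (8 * lam)) * (1 - x ^ 2) ^ 2) * Real.exp (-(lam / (2 * h ^ 2)) * x ^ 2) *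
      (Real.exp (-(1 / (8 * lam)) * (1 - y ^ 2) ^ 2) * Real.exp (-(lam / (2 * h ^ 2)) * y ^ 2)) *
        ((lam / h ^ 2 * (x * y)) ^ n / n.factorial) := by
  have h1 := Real.mul_self_sqrt (show 0 ≤ (lam / h ^ 2) ^ n / n.factorial by positivity)
  rw [mul_pow, mul_pow, mul_div_right_comm, ← h1]
  unfold feature
  ring

theorem hasSum_kernel (hh : 0 < h) (x y : ℝ) :
    HasSum (fun n => feature lam h n x * feature lam h n y) (kernel lam h x y) := by
  have h1 := NormedSpace.expSeries_div_hasSum_exp (lam / h ^ 2 * (x * y))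
  rw [← Real.exp_eq_exp_ℝ] at h1
  have h2 := h1.mul_left (Real.exp (-(1 / (8 * lam)) * (1 - x ^ 2) ^ 2) *
    Real.exp (-(lam / (2 * h ^ 2)) * x ^ 2) * (Real.exp (-(1 / (8 * lam)) * (1 - y ^ 2) ^ 2) *
      Real.exp (-(lam / (2 * h ^ 2)) * y ^ 2)))
  simp only [feature_mul_feature hlam]
  have h3 : kernel lam h x y = Real.exp (-(1 / (8 * lam)) * (1 - x ^ 2) ^ 2) *
      Real.exp (-(lam / (2 * h ^ 2)) * x ^ 2) * (Real.exp (-(1 / (8 * lam)) * (1 - y ^ 2) ^ 2) *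
      Real.exp (-(lam / (2 * h ^ 2)) * y ^ 2)) * Real.exp (lam / h ^ 2 * (x * y)) := by
    unfold kernel
    simp only [← Real.exp_add]
    congr 1
    field_simp
    ring
  rw [h3]
  exact h2

theorem feature_sq_le {x : ℝ} (hx : x ∈ Icc (-R) R) (n : ℕ) :
    feature lam h n x ^ 2 ≤ (lam / h ^ 2 * R ^ 2) ^ n / n.factorial := by
  have hxR : x * x ≤ R ^ 2 := by nlinarith [hx.1, hx.2]
  rw [sq, feature_mul_feature hlam]
  have he : ∀ c z : ℝ, 0 ≤ c → Real.exp (-c * z ^ 2) ≤ 1 := fun c z hc =>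
    Real.exp_le_one_iff.2 (by nlinarith [sq_nonneg z])
  have h1 := he (1 / (8 * lam)) (1 - x ^ 2) (by positivity)
  have h2 := he (lam / (2 * h ^ 2)) x (by positivity)
  have h3 := mul_le_one₀ h1 (Real.exp_pos _).le h2
  have h4 := mul_le_one₀ h3 (by positivity) h3
  have h5 : (lam / h ^ 2 * (x * x)) ^ n / n.factorial ≤
      (lam / h ^ 2 * R ^ 2) ^ n / n.factorial := by
    have := mul_self_nonneg x
    gcongr
  exact (mul_le_of_le_one_left (by have := mul_self_nonneg x; positivity) h4).trans h5

theorem norm_featureLp_sq_le (hR : 0 < R) (n : ℕ) :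
    ‖featureLp lam h R n‖ ^ 2 ≤ 2 * R * ((lam / h ^ 2 * R ^ 2) ^ n / n.factorial) :=
  norm_toLp_sq_le hR _ fun _ hx => feature_sq_le hlam hx n

theorem summable_norm_featureLp_sq (hR : 0 < R) :
    Summable fun n => ‖featureLp lam h R n‖ ^ 2 :=
  Summable.of_nonneg_of_le (fun _ => sq_nonneg _) (norm_featureLp_sq_le hlam hR)
    ((Real.summable_pow_div_factorial _).mul_left _)

/-- An exponential Chebyshev-type trick: on the tail, the weight `exp(α(n+J)) exp(-αJ)` is at least
`1`, and inserting it leaves part of the series of `exp(s exp α)`. -/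
theorem tsum_norm_featureLp_sq_le (hR : 0 < R) {α : ℝ} (hα : 0 < α) (J : ℕ) :
    ∑' n, ‖featureLp lam h R (n + J)‖ ^ 2 ≤
      2 * R * Real.exp (lam / h ^ 2 * R ^ 2 * Real.exp α) * Real.exp (-(α * J)) := by
  set s := lam / h ^ 2 * R ^ 2
  have hs : 0 ≤ s := by positivity
  have h1 := NormedSpace.expSeries_div_hasSum_exp (s * Real.exp α)
  rw [← Real.exp_eq_exp_ℝ] at h1
  have h2 := (h1.mul_left (2 * R)).mul_right (Real.exp (-(α * J)))
  rw [← h2.tsum_eq, ← h2.summable.sum_add_tsum_nat_add J]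
  have hterm : ∀ n, ‖featureLp lam h R (n + J)‖ ^ 2 ≤
      2 * R * ((s * Real.exp α) ^ (n + J) / (n + J).factorial) * Real.exp (-(α * J)) := by
    intro n
    refine (norm_featureLp_sq_le hlam hR _).trans ?_
    rw [mul_assoc (2 * R)]
    refine mul_le_mul_of_nonneg_left ?_ (show (0 : ℝ) ≤ 2 * R by positivity)
    have h3 : 1 ≤ Real.exp α ^ (n + J) * Real.exp (-(α * J)) := by
      rw [← Real.exp_nat_mul, ← Real.exp_add]
      refine Real.one_le_exp ?_
      push_cast
      have : 0 ≤ (n : ℝ) * α := by positivity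
      linarith
    rw [mul_pow s, mul_div_right_comm, mul_assoc (s ^ (n + J) / _)]
    exact le_mul_of_one_le_right (by positivity) h3
  have hle := Summable.tsum_le_tsum hterm
    ((summable_nat_add_iff J).2 (summable_norm_featureLp_sq hlam hR))
    ((summable_nat_add_iff J).2 h2.summable)
  refine hle.trans (le_add_of_nonneg_left (Finset.sum_nonneg fun n _ => ?_))
  positivity

theorem hasSum_integral_kernel (hh : 0 < h) {x : ℝ} (hx : x ∈ Icc (-R) R) (f : L2I R) :
    HasSum (fun n => feature lam h n x * inner ℝ (featureLp lam h R n) f)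
      (∫ y, kernel lam h x y * f y ∂(muI R)) := by
  have hR : 0 ≤ R := by linarith [hx.1, hx.2]
  have hb : ∀ n, ∀ y ∈ Icc (-R) R, |feature lam h n x * feature lam h n y| ≤
      (lam / h ^ 2 * R ^ 2) ^ n / n.factorial := by
    intro n y hy
    have h1 := feature_sq_le (h := h) hlam hx n
    have h2 := feature_sq_le (h := h) hlam hy n
    rw [abs_le]
    constructor <;> nlinarith [sq_nonneg (feature lam h n x + feature lam h n y),
      sq_nonneg (feature lam h n x - feature lam h n y)]
  have h1 : ∀ n, feature lam h n x * inner ℝ (featureLp lam h R n) f =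
      ∫ y, feature lam h n x * feature lam h n y * f y ∂(muI R) := fun n => by
    rw [featureLp, inner_toLp, ← integral_const_mul]
    simp only [mul_assoc]
  simp only [h1]
  refine hasSum_integral_of_dominated_convergence
    (fun n y => (lam / h ^ 2 * R ^ 2) ^ n / n.factorial * ‖f y‖) (fun n => ?_) (fun n => ?_) ?_ ?_ ?_
  · exact ((continuous_const.mul (continuous_feature lam h n)).aestronglyMeasurable).mul
      (integrable_L2I f).1
  · filter_upwards [ae_restrict_mem measurableSet_Icc] with y hy
    rw [norm_mul]
    exact mul_le_mul_of_nonneg_right (hb n y hy) (norm_nonneg _)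
  · exact Eventually.of_forall fun y => (Real.summable_pow_div_factorial _).mul_right _
  · simp only [tsum_mul_right]
    exact (integrable_L2I f).norm.const_mul _
  · exact Eventually.of_forall fun y => (hasSum_kernel hlam hh x y).mul_right _

omit hlam in
theorem opH0_ae_eq (f : L2I R) :
    opH0 lam h R f =ᵐ[muI R] fun x => ∫ y, kernel lam h x y * f y ∂(muI R) :=
  (memLp_integral_kernel lam h f).coeFn_toLp

/-- The series converges absolutely since `∑ ‖gₙ‖²` is finite. To identify its sum, a subsequence of
the `L²`-convergent partial sums converges a.e., while `hasSum_integral_kernel` gives their limit at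
every point of the interval. -/
theorem hasSum_opH0 (hh : 0 < h) (hR : 0 < R) :
    HasSum (fun n => rankOne ℝ (featureLp lam h R n) (featureLp lam h R n)) (opH0 lam h R) := by
  have hs : Summable fun n => rankOne ℝ (featureLp lam h R n) (featureLp lam h R n) := by
    refine Summable.of_norm ?_
    simpa [← sq] using summable_norm_featureLp_sq (h := h) hlam hR
  convert hs.hasSum
  ext1 f
  have h1 := (hs.hasSum.mapL (ContinuousLinearMap.apply ℝ _ f)).tendsto_sum_nat
  obtain ⟨ns, hns, hae⟩ := (tendstoInMeasure_of_tendsto_Lp h1).exists_seq_tendsto_ae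
  refine Lp.ext ?_
  have h2 : ∀ᵐ x ∂(muI R), ∀ N : ℕ,
      (∑ n ∈ Finset.range N, ContinuousLinearMap.apply ℝ _ f
        (rankOne ℝ (featureLp lam h R n) (featureLp lam h R n)) : L2I R) x =
      ∑ n ∈ Finset.range N, feature lam h n x * inner ℝ (featureLp lam h R n) f := by
    rw [ae_all_iff]
    intro N
    have h3 : ∀ᵐ x ∂(muI R), ∀ n : ℕ, (ContinuousLinearMap.apply ℝ _ f
        (rankOne ℝ (featureLp lam h R n) (featureLp lam h R n)) : L2I R) x =
          feature lam h n x * inner ℝ (featureLp lam h R n) f := by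
      rw [ae_all_iff]
      intro n
      filter_upwards [Lp.coeFn_smul (inner ℝ (featureLp lam h R n) f) (featureLp lam h R n),
        (memLp_feature lam h R n).coeFn_toLp] with x hx hx'
      simp only [ContinuousLinearMap.apply_apply, rankOne_apply]
      rw [hx, Pi.smul_apply, smul_eq_mul, mul_comm]
      congr 1
    filter_upwards [h3, Lp.coeFn_finsetSum (Finset.range N) fun n =>
      (ContinuousLinearMap.apply ℝ _ f
        (rankOne ℝ (featureLp lam h R n) (featureLp lam h R n)) : L2I R)] with x hx hx'
    rw [hx', Finset.sum_apply]
    exact Finset.sum_congr rfl fun n _ => hx n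
  filter_upwards [hae, h2, opH0_ae_eq (lam := lam) (h := h) f,
    ae_restrict_mem measurableSet_Icc] with x hx hx2 hx3 hx4
  rw [hx3]
  simp only [hx2] at hx
  exact tendsto_nhds_unique
    ((hasSum_integral_kernel hlam hh hx4 f).tendsto_sum_nat.comp hns.tendsto_atTop) hx

/-- Up to positive constants, `gₙ` is `w(y) yⁿ` with `w > 0`. So `w f` is orthogonal to all
monomials, then to polynomials, then by Weierstrass to continuous functions, hence vanishes a.e. -/
theorem eq_zero_of_inner_featureLp_eq_zero (hh : 0 < h) (f : L2I R)
    (hf : ∀ n, inner ℝ (featureLp lam h R n) f = 0) : f = 0 := by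
  let w : ℝ → ℝ := fun x =>
    Real.exp (-(1 / (8 * lam)) * (1 - x ^ 2) ^ 2) * Real.exp (-(lam / (2 * h ^ 2)) * x ^ 2)
  have hw : Continuous w := by fun_prop
  have hwpos : ∀ x, 0 < w x := fun x => by positivity
  have hint : ∀ p : ℝ → ℝ, ContinuousOn p (Icc (-R) R) →
      Integrable (fun y => p y * (w y * f y)) (muI R) := by
    intro p hp
    have := (memLp_of_continuousOn (hp.mul hw.continuousOn)).integrable_mul (Lp.memLp f)
    refine this.congr (Eventually.of_forall fun y => ?_)
    simp [mul_assoc]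
  have hmono : ∀ n : ℕ, ∫ y, y ^ n * (w y * f y) ∂(muI R) = 0 := by
    intro n
    have h1 := hf n
    rw [featureLp, inner_toLp] at h1
    have h2 : ∀ y, feature lam h n y * f y =
        Real.sqrt ((lam / h ^ 2) ^ n / n.factorial) * (y ^ n * (w y * f y)) := fun y => by
      simp only [feature, w]; ring
    simp only [h2] at h1
    rw [integral_const_mul] at h1
    refine (mul_eq_zero.1 h1).resolve_left (Real.sqrt_pos.2 ?_).ne'
    positivity
  have hpoly : ∀ p : Polynomial ℝ, ∫ y, p.eval y * (w y * f y) ∂(muI R) = 0 := by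
    intro p
    simp only [Polynomial.eval_eq_sum_range, Finset.sum_mul]
    rw [integral_finsetSum _ fun n _ => hint _ (by fun_prop)]
    refine Finset.sum_eq_zero fun n _ => ?_
    simp only [mul_assoc]
    rw [integral_const_mul, hmono, mul_zero]
  have hcont : ∀ g : ℝ → ℝ, Continuous g → ∫ y, g y * (w y * f y) ∂(muI R) = 0 := by
    intro g hg
    have hwf := hint (fun _ => 1) continuousOn_const
    simp only [one_mul] at hwf
    set C := ∫ y, ‖w y * f y‖ ∂(muI R)
    have hC : 0 ≤ C := integral_nonneg fun _ => norm_nonneg _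
    refine norm_le_zero_iff.1 (le_of_forall_pos_le_add fun ε hε => ?_)
    obtain ⟨p, hp⟩ := exists_polynomial_near_of_continuousOn (-R) R g hg.continuousOn (ε / (C + 1))
      (by positivity)
    have h1 : ∫ y, g y * (w y * f y) ∂(muI R) =
        ∫ y, (g y - p.eval y) * (w y * f y) ∂(muI R) := by
      simp only [sub_mul]
      rw [integral_sub (hint g hg.continuousOn) (hint _ p.continuous.continuousOn), hpoly, sub_zero]
    rw [h1, zero_add]
    have h2 : ‖∫ y, (g y - p.eval y) * (w y * f y) ∂(muI R)‖ ≤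
        ∫ y, ε / (C + 1) * ‖w y * f y‖ ∂(muI R) := by
      refine norm_integral_le_of_norm_le (hwf.norm.const_mul _) ?_
      filter_upwards [ae_restrict_mem measurableSet_Icc] with y hy
      rw [norm_mul]
      refine mul_le_mul_of_nonneg_right ?_ (norm_nonneg _)
      rw [Real.norm_eq_abs, abs_sub_comm]
      exact (hp y hy).le
    rw [integral_const_mul] at h2
    refine h2.trans ?_
    rw [div_mul_eq_mul_div, div_le_iff₀ (by positivity)]
    nlinarith
  have hwf := hint (fun _ => 1) continuousOn_const
  simp only [one_mul] at hwf
  have hzero := ae_eq_zero_of_integral_contDiff_smul_eq_zero (μ := muI R)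
    (f := fun y => w y * f y) hwf.locallyIntegrable fun g hg _ => hcont g hg.continuous
  refine Lp.ext ?_
  filter_upwards [hzero, Lp.coeFn_zero ℝ 2 (muI R)] with y hy hy0
  rw [hy0]
  exact (mul_eq_zero.1 hy).resolve_left (hwpos y).ne'

end

/-! ### Pointwise properties of the kernel and existence of an eigendecomposition. -/

theorem kernel_nonneg (lam h x y : ℝ) : 0 ≤ kernel lam h x y := by
  unfold kernel; positivity

theorem kernel_comm (lam h x y : ℝ) : kernel lam h x y = kernel lam h y x := by
  unfold kernel
  rw [show (x - y) ^ 2 = (y - x) ^ 2 by ring]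
  ring

theorem kernel_le_one {lam : ℝ} (hlam : 0 < lam) (h x y : ℝ) : kernel lam h x y ≤ 1 := by
  have he : ∀ c z : ℝ, 0 ≤ c → Real.exp (-c * z ^ 2) ≤ 1 := fun c z hc =>
    Real.exp_le_one_iff.2 (by nlinarith [sq_nonneg z])
  unfold kernel
  exact mul_le_one₀ (mul_le_one₀ (he _ _ (by positivity)) (Real.exp_pos _).le
    (he _ _ (by positivity))) (Real.exp_pos _).le (he _ _ (by positivity))

theorem memLp_kernel (lam h R x : ℝ) : MemLp (kernel lam h x) 2 (muI R) :=
  memLp_of_continuousOn ((continuous_kernel lam h).comp (Continuous.prodMk_right x)).continuousOn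

theorem continuous_integral_kernel {lam : ℝ} (hlam : 0 < lam) (h : ℝ) {R : ℝ} (f : L2I R) :
    Continuous fun x => ∫ y, kernel lam h x y * f y ∂(muI R) := by
  refine continuous_of_dominated (bound := fun y => ‖f y‖) (fun x => ?_) (fun x => ?_)
    (integrable_L2I f).norm (Eventually.of_forall fun y => ?_)
  · exact ((continuous_kernel lam h).comp (Continuous.prodMk_right x)).aestronglyMeasurable.mul
      (integrable_L2I f).1
  · refine Eventually.of_forall fun y => ?_
    rw [norm_mul, Real.norm_of_nonneg (kernel_nonneg _ _ _ _)]
    exact mul_le_of_le_one_left (norm_nonneg _) (kernel_le_one hlam _ _ _)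
  · exact ((continuous_kernel lam h).comp (Continuous.prodMk_left y)).mul continuous_const

/-- The truncated Mercer kernel `∑_{j<J} v_j(x) v_j(y)`. -/
def mercerSum (ev : ℕ → ℝ) (u : ℕ → ℝ → ℝ) (J : ℕ) (x y : ℝ) : ℝ :=
  ∑ j ∈ Finset.range J, vFun ev u j x * vFun ev u j y

theorem exists_isEigendecomposition {lam h R : ℝ} (hlam : 0 < lam) (hh : 0 < h) (hR : 0 < R) :
    ∃ (ev : ℕ → ℝ) (u : ℕ → ℝ → ℝ), IsEigendecomposition lam h R ev u := by
  obtain ⟨b, ev, hanti, hpos, hb⟩ := exists_hilbertBasis_antitone (hasSum_opH0 hlam hh hR)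
    (summable_norm_featureLp_sq hlam hR) (eq_zero_of_inner_featureLp_eq_zero hlam hh)
    (not_finiteDimensional_L2I hR)
  -- Since `ev j > 0`, the eigenvalue equation itself supplies a continuous representative of `b j`.
  refine ⟨ev, fun j x => (ev j)⁻¹ * ∫ y, kernel lam h x y * b j y ∂(muI R), ?_, fun j => (hpos j).le,
    hanti, b, fun j => ⟨?_, hb j⟩⟩
  · exact fun j => (continuous_const.mul (continuous_integral_kernel hlam h _)).continuousOn
  · have h1 := opH0_ae_eq (lam := lam) (h := h) (b j)
    rw [hb j] at h1
    filter_upwards [h1, Lp.coeFn_smul (ev j) (b j)] with x hx hx'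
    rw [← hx, hx', Pi.smul_apply, smul_eq_mul, inv_mul_cancel_left₀ (hpos j).ne']

/-! ### Mercer-type estimates for an arbitrary eigendecomposition. -/

section

variable {lam h R : ℝ} {ev : ℕ → ℝ} {u : ℕ → ℝ → ℝ}

theorem vFun_mul_vFun (hu : IsEigendecomposition lam h R ev u) (j : ℕ) (x y : ℝ) :
    vFun ev u j x * vFun ev u j y = ev j * u j x * u j y := by
  unfold vFun
  rw [← Real.mul_self_sqrt (hu.nonneg j), Real.sqrt_mul_self (Real.sqrt_nonneg _)]
  ring

theorem continuousOn_vFun (hu : IsEigendecomposition lam h R ev u) (j : ℕ) :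
    ContinuousOn (vFun ev u j) (Icc (-R) R) :=
  continuousOn_const.mul (hu.continuousOn j)

theorem IsEigendecomposition.summable (hlam : 0 < lam) (hh : 0 < h) (hR : 0 < R)
    (hu : IsEigendecomposition lam h R ev u) : Summable ev := by
  obtain ⟨b, hb⟩ := hu.basis
  exact summable_eigenvalues (hasSum_opH0 hlam hh hR) (summable_norm_featureLp_sq hlam hR)
    b.orthonormal fun j => (hb j).2

theorem IsEigendecomposition.le_exp (hlam : 0 < lam) (hh : 0 < h) (hR : 0 < R)
    (hu : IsEigendecomposition lam h R ev u) {α : ℝ} (hα : 0 < α) (J : ℕ) :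
    ev J ≤ 2 * R * Real.exp (lam / h ^ 2 * R ^ 2 * Real.exp α) * Real.exp (-(α * J)) := by
  obtain ⟨b, hb⟩ := hu.basis
  exact (eigenvalue_le_tsum_norm_sq (hasSum_opH0 hlam hh hR) (summable_norm_featureLp_sq hlam hR)
    b.orthonormal (fun j => (hb j).2) hu.antitone J).trans
      (tsum_norm_featureLp_sq_le hlam hR hα J)

/-- Both sides are continuous, so the a.e. eigenvalue equation holds at every point; the argument
needs it pointwise, in particular at `x = 0`. -/
theorem eigenvalue_mul_eigenfunction (hlam : 0 < lam) (hR : 0 < R)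
    (hu : IsEigendecomposition lam h R ev u) {b : HilbertBasis ℕ ℝ (L2I R)}
    (hb : ∀ j, (b j : ℝ → ℝ) =ᵐ[muI R] u j ∧ opH0 lam h R (b j) = ev j • b j) (j : ℕ) {x : ℝ}
    (hx : x ∈ Icc (-R) R) : ∫ y, kernel lam h x y * b j y ∂(muI R) = ev j * u j x := by
  have h1 : (fun x => ∫ y, kernel lam h x y * b j y ∂(muI R)) =ᵐ[muI R]
      fun x => ev j * u j x := by
    have h2 := opH0_ae_eq (lam := lam) (h := h) (b j)
    rw [(hb j).2] at h2
    filter_upwards [h2, Lp.coeFn_smul (ev j) (b j), (hb j).1] with x hx hx' hx''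
    rw [← hx, hx', Pi.smul_apply, smul_eq_mul, hx'']
  exact Measure.eqOn_Icc_of_ae_eq (volume : Measure ℝ) (by linarith : -R ≠ R) h1
    (continuous_integral_kernel hlam h _).continuousOn
    (continuousOn_const.mul (hu.continuousOn j)) hx

/-- With `f = ∑_{j ∈ s} u j x • b j`, expand `0 ≤ ∑ₙ (gₙ(x) - ⟨gₙ, f⟩)²`. The square terms are
`K(x,x)` and `⟨H₀ f, f⟩`, the cross term is `-2 (H₀ f)(x)`, and both `⟨H₀ f, f⟩` and `(H₀ f)(x)`
equal the sum on the left. -/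
theorem sum_eigenvalue_mul_sq_le (hlam : 0 < lam) (hh : 0 < h) (hR : 0 < R)
    (hu : IsEigendecomposition lam h R ev u) (s : Finset ℕ) {x : ℝ} (hx : x ∈ Icc (-R) R) :
    ∑ j ∈ s, ev j * u j x ^ 2 ≤ kernel lam h x x := by
  obtain ⟨b, hb⟩ := hu.basis
  set f : L2I R := ∑ j ∈ s, u j x • b j with hf
  have h1 := hasSum_kernel hlam hh x x
  have h2 : HasSum (fun n => feature lam h n x * inner ℝ (featureLp lam h R n) f)
      (∑ j ∈ s, ev j * u j x ^ 2) := by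
    have h3 := hasSum_sum (s := s) fun j _ =>
      (hasSum_integral_kernel hlam hh hx (b j)).mul_left (u j x)
    simp only [eigenvalue_mul_eigenfunction hlam hR hu hb _ hx] at h3
    have h4 : ∀ n, feature lam h n x * inner ℝ (featureLp lam h R n) f =
        ∑ j ∈ s, u j x * (feature lam h n x * inner ℝ (featureLp lam h R n) (b j)) := by
      intro n
      rw [hf, inner_sum, Finset.mul_sum]
      refine Finset.sum_congr rfl fun j _ => ?_
      rw [inner_smul_right]; ring
    have h5 : ∑ j ∈ s, ev j * u j x ^ 2 = ∑ j ∈ s, u j x * (ev j * u j x) :=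
      Finset.sum_congr rfl fun j _ => by ring
    simp only [h4, h5]
    exact h3
  have h3 := hasSum_inner_sq (hasSum_opH0 hlam hh hR) f
  have h4 : inner ℝ (opH0 lam h R f) f = ∑ j ∈ s, ev j * u j x ^ 2 := by
    have : opH0 lam h R f = ∑ j ∈ s, (u j x * ev j) • b j := by
      simp [hf, map_sum, (hb _).2, smul_smul]
    rw [this, hf, b.orthonormal.inner_sum]
    exact Finset.sum_congr rfl fun j _ => by simp; ring
  rw [h4] at h3
  have h5 := ((h1.sub (h2.mul_left 2)).add h3).nonneg fun n => by
    nlinarith [sq_nonneg (feature lam h n x - inner ℝ (featureLp lam h R n) f)]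
  linarith

theorem mercerSum_self_le (hlam : 0 < lam) (hh : 0 < h) (hR : 0 < R)
    (hu : IsEigendecomposition lam h R ev u) (J : ℕ) {x : ℝ} (hx : x ∈ Icc (-R) R) :
    mercerSum ev u J x x ≤ kernel lam h x x := by
  refine le_trans (le_of_eq ?_) (sum_eigenvalue_mul_sq_le hlam hh hR hu (Finset.range J) hx)
  exact Finset.sum_congr rfl fun j _ => by rw [vFun_mul_vFun hu]; ring

theorem integral_vFun_sq (hu : IsEigendecomposition lam h R ev u) (j : ℕ) :
    ∫ x, vFun ev u j x * vFun ev u j x ∂(muI R) = ev j := by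
  obtain ⟨b, hb⟩ := hu.basis
  have h1 : (1 : ℝ) = ∫ x, u j x * u j x ∂(muI R) := by
    have h2 : inner ℝ (b j) (b j) = (1 : ℝ) := by
      rw [real_inner_self_eq_norm_sq, b.orthonormal.1 j, one_pow]
    rw [← h2, L2.inner_def]
    refine integral_congr_ae ?_
    filter_upwards [(hb j).1] with x hx
    simp [hx, sq]
  simp only [vFun_mul_vFun hu, mul_assoc]
  rw [integral_const_mul, ← h1, mul_one]

theorem integral_mercerSum_self_le (hlam : 0 < lam) (hh : 0 < h) (hR : 0 < R)
    (hu : IsEigendecomposition lam h R ev u) (J : ℕ) :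
    ∫ x, mercerSum ev u J x x ∂(muI R) ≤ ∑' j, ev j := by
  unfold mercerSum
  have hint : ∀ j, Integrable (fun x => vFun ev u j x * vFun ev u j x) (muI R) := fun j =>
    ((continuousOn_vFun hu j).mul (continuousOn_vFun hu j)).integrableOn_Icc
  rw [integral_finsetSum _ fun j _ => hint j]
  simp only [integral_vFun_sq hu]
  exact (hu.summable hlam hh hR).sum_le_tsum _ fun j _ => hu.nonneg j

/-- The remainder in `y` has coefficients `ev j * u j x` for `j ≥ J` only. By monotonicity their
squares are at most `ev J * (ev j * u j x ^ 2)`, so Parseval and the diagonal inequality bound the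
squared `L²` norm by `ev J * K(x,x) ≤ ev J`. Cauchy-Schwarz passes to `L¹`. -/
theorem integral_abs_kernel_sub_mercerSum_le (hlam : 0 < lam) (hh : 0 < h) (hR : 0 < R)
    (hu : IsEigendecomposition lam h R ev u) (J : ℕ) {x : ℝ} (hx : x ∈ Icc (-R) R) :
    ∫ y, |kernel lam h x y - mercerSum ev u J x y| ∂(muI R) ≤ Real.sqrt (2 * R * ev J) := by
  obtain ⟨b, hb⟩ := hu.basis
  set k : L2I R := (memLp_kernel lam h R x).toLp _
  have hk : ∀ j, inner ℝ (b j) k = ev j * u j x := fun j => by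
    rw [real_inner_comm, inner_toLp, eigenvalue_mul_eigenfunction hlam hR hu hb j hx]
  set r : L2I R := k - ∑ j ∈ Finset.range J, (ev j * u j x) • b j
  have hr : ∀ᵐ y ∂(muI R), r y = kernel lam h x y - mercerSum ev u J x y := by
    have h3 : ∀ᵐ y ∂(muI R), ∀ j : ℕ, ((ev j * u j x) • b j : L2I R) y =
        vFun ev u j x * vFun ev u j y := by
      rw [ae_all_iff]
      intro j
      filter_upwards [Lp.coeFn_smul (ev j * u j x) (b j), (hb j).1] with y hy hy'
      rw [hy, Pi.smul_apply, smul_eq_mul, hy', vFun_mul_vFun hu]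
    filter_upwards [Lp.coeFn_sub k (∑ j ∈ Finset.range J, (ev j * u j x) • b j), h3,
      (memLp_kernel lam h R x).coeFn_toLp,
      Lp.coeFn_finsetSum (Finset.range J) fun j => ((ev j * u j x) • b j : L2I R)]
      with y hy1 hy2 hy3 hy4
    rw [hy1, Pi.sub_apply, hy3, hy4, Finset.sum_apply]
    unfold mercerSum
    simp only [hy2]
  have hbr : ∀ j, inner ℝ (b j) r * inner ℝ (b j) r ≤ ev J * (ev j * u j x ^ 2) := by
    intro j
    have h1 : inner ℝ (b j) r = if j < J then 0 else ev j * u j x := by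
      simp only [r, inner_sub_right, inner_sum, inner_smul_right, hk,
        orthonormal_iff_ite.1 b.orthonormal]
      split_ifs with hj <;> simp [hj]
    rw [h1]
    split_ifs with hj
    · have := hu.nonneg J
      have := hu.nonneg j
      simp only [mul_zero]; positivity
    · have h2 := hu.antitone (not_lt.1 hj)
      have h3 : 0 ≤ ev j * u j x ^ 2 := mul_nonneg (hu.nonneg j) (sq_nonneg _)
      nlinarith
  have hrnorm : ‖r‖ ^ 2 ≤ ev J := by
    rw [← real_inner_self_eq_norm_sq]
    have h1 := b.hasSum_inner_mul_inner r r
    refine hasSum_le_of_sum_le h1 fun s => ?_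
    have h2 : ∑ j ∈ s, inner ℝ r (b j) * inner ℝ (b j) r ≤
        ∑ j ∈ s, ev J * (ev j * u j x ^ 2) :=
      Finset.sum_le_sum fun j _ => by rw [real_inner_comm]; exact hbr j
    refine h2.trans ?_
    rw [← Finset.mul_sum]
    exact mul_le_of_le_one_right (hu.nonneg J)
      ((sum_eigenvalue_mul_sq_le hlam hh hR hu s hx).trans (kernel_le_one hlam _ _ _))
  have h1 : ∫ y, |kernel lam h x y - mercerSum ev u J x y| ∂(muI R) = ∫ y, ‖r y‖ ∂(muI R) := by
    refine integral_congr_ae ?_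
    filter_upwards [hr] with y hy
    rw [hy, Real.norm_eq_abs]
  have h2 : ((muI R) univ ^ (1 / 2 : ℝ)).toReal = Real.sqrt (2 * R) := by
    rw [← ENNReal.toReal_rpow, ← Real.sqrt_eq_rpow, ← muI_real_univ hR, Measure.real]
  rw [h1, Real.sqrt_mul (by positivity)]
  refine (integral_norm_le r).trans ?_
  rw [h2, mul_comm]
  exact mul_le_mul_of_nonneg_left (Real.le_sqrt_of_sq_le hrnorm) (Real.sqrt_nonneg _)

end

/-! ### Decay and convergence of the cosine coefficients of `θ ↦ f (cos θ)`. -/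

section CosineCoefficients

open Real

/-- `∫_0^π f(cos θ) cos(kθ) dθ`. -/
def cosInt (f : ℝ → ℝ) (k : ℕ) : ℝ := ∫ θ in (0 : ℝ)..π, f (cos θ) * cos (k * θ)

theorem continuous_comp_cos {f : ℝ → ℝ} (hf : ContinuousOn f (Icc (-1) 1)) :
    Continuous fun θ => f (cos θ) :=
  hf.comp_continuous continuous_cos fun θ => cos_mem_Icc θ

theorem cosInt_eq_integral_derivWithin {f : ℝ → ℝ} (hf : ContDiffOn ℝ 1 f (Icc (-1) 1)) {k : ℕ}
    (hk : 0 < k) : cosInt f k =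
      1 / k * ∫ θ in (0 : ℝ)..π, derivWithin f (Icc (-1) 1) (cos θ) * sin θ * sin (k * θ) := by
  have hk' : (k : ℝ) ≠ 0 := by positivity
  have hf' : ContinuousOn (derivWithin f (Icc (-1) 1)) (Icc (-1) 1) :=
    hf.continuousOn_derivWithin (uniqueDiffOn_Icc (by norm_num)) le_rfl
  have h1 := intervalIntegral.integral_mul_deriv_eq_deriv_mul_of_hasDerivAt (a := 0) (b := π)
    (u := fun θ => f (cos θ)) (v := fun θ => sin (k * θ) / k)
    (u' := fun θ => derivWithin f (Icc (-1) 1) (cos θ) * (-sin θ)) (v' := fun θ => cos (k * θ))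
    (continuous_comp_cos hf.continuousOn).continuousOn (by fun_prop) ?_ ?_ ?_ ?_
  · rw [cosInt, h1, ← intervalIntegral.integral_const_mul]
    simp only [sin_nat_mul_pi, mul_zero, sin_zero, zero_div, sub_self, zero_sub]
    rw [← intervalIntegral.integral_neg]
    refine intervalIntegral.integral_congr fun θ _ => ?_
    field_simp
  -- For `θ` strictly between `0` and `π`, `cos θ` is interior to `[-1, 1]`, so the one-sided
  -- derivative is a genuine one.
  · intro θ hθ
    rw [min_eq_left pi_pos.le, max_eq_right pi_pos.le] at hθ
    have hmem : cos θ ∈ Ioo (-1 : ℝ) 1 := by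
      have hs := sin_pos_of_mem_Ioo hθ
      have hsq := sin_sq_add_cos_sq θ
      constructor <;> nlinarith
    have h2 : HasDerivAt f (derivWithin f (Icc (-1) 1) (cos θ)) (cos θ) :=
      ((hf.differentiableOn (by norm_num)) _ (Ioo_subset_Icc_self hmem)).hasDerivWithinAt.hasDerivAt
        (Icc_mem_nhds hmem.1 hmem.2)
    exact h2.comp θ (hasDerivAt_cos θ)
  · intro θ _
    have h2 := ((hasDerivAt_id θ).const_mul (k : ℝ)).sin.div_const (k : ℝ)
    simpa [hk'] using h2
  · exact ((continuous_comp_cos hf').mul continuous_sin.neg).intervalIntegrable _ _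
  · exact Continuous.intervalIntegrable (by fun_prop) _ _

/-- Integration by parts, then `2 sin θ sin((k+1)θ) = cos(kθ) - cos((k+2)θ)`. This trades one
derivative for a factor `1/(k+1)` and drives the induction in `abs_cosInt_le_descFactorial`. -/
theorem cosInt_succ_succ {f : ℝ → ℝ} (hf : ContDiffOn ℝ 1 f (Icc (-1) 1)) (k : ℕ) :
    cosInt f (k + 1) = 1 / (k + 1 : ℕ) * ((cosInt (derivWithin f (Icc (-1) 1)) k -
      cosInt (derivWithin f (Icc (-1) 1)) (k + 2)) / 2) := by
  have hf' : ContinuousOn (derivWithin f (Icc (-1) 1)) (Icc (-1) 1) :=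
    hf.continuousOn_derivWithin (uniqueDiffOn_Icc (by norm_num)) le_rfl
  have hint : ∀ m : ℕ, IntervalIntegrable
      (fun θ => derivWithin f (Icc (-1) 1) (cos θ) * cos (m * θ)) volume 0 π := fun m =>
    ((continuous_comp_cos hf').mul (by fun_prop)).intervalIntegrable _ _
  rw [cosInt_eq_integral_derivWithin hf k.succ_pos, cosInt, cosInt,
    ← intervalIntegral.integral_sub (hint _) (hint _), ← intervalIntegral.integral_div]
  congr 1
  refine intervalIntegral.integral_congr fun θ _ => ?_
  have h1 : cos (k * θ) = cos ((k + 1 : ℕ) * θ - θ) := by push_cast; ring_nf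
  have h2 : cos ((k + 2 : ℕ) * θ) = cos ((k + 1 : ℕ) * θ + θ) := by push_cast; ring_nf
  rw [h1, h2, cos_sub, cos_add]
  ring

/-- Bounding `|sin(kθ)|` by `1` leaves the factor `sin θ` as the Jacobian of `t = cos θ`, which
produces the unweighted `L¹` norm. -/
theorem abs_cosInt_le_integral_abs_derivWithin {f : ℝ → ℝ} (hf : ContDiffOn ℝ 1 f (Icc (-1) 1))
    {k : ℕ} (hk : 0 < k) :
    |cosInt f k| ≤ (∫ t in (-1 : ℝ)..1, |derivWithin f (Icc (-1) 1) t|) / k := by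
  have hf' : ContinuousOn (derivWithin f (Icc (-1) 1)) (Icc (-1) 1) :=
    hf.continuousOn_derivWithin (uniqueDiffOn_Icc (by norm_num)) le_rfl
  have h1 : ∫ θ in (0 : ℝ)..π, |derivWithin f (Icc (-1) 1) (cos θ)| * (-sin θ) =
      ∫ t in cos 0..cos π, |derivWithin f (Icc (-1) 1) t| := by
    refine intervalIntegral.integral_comp_mul_deriv' (g := fun t => |derivWithin f (Icc (-1) 1) t|)
      (fun θ _ => hasDerivAt_cos θ) continuous_sin.neg.continuousOn (hf'.abs.mono ?_)
    rintro _ ⟨θ, _, rfl⟩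
    exact cos_mem_Icc θ
  rw [cos_zero, cos_pi, intervalIntegral.integral_symm (-1) 1] at h1
  simp only [mul_neg, intervalIntegral.integral_neg, neg_inj] at h1
  rw [cosInt_eq_integral_derivWithin hf hk, ← h1, abs_mul, abs_of_nonneg (by positivity),
    one_div, div_eq_inv_mul]
  refine mul_le_mul_of_nonneg_left ?_ (by positivity)
  rw [← Real.norm_eq_abs]
  refine intervalIntegral.norm_integral_le_of_norm_le (μ := volume) pi_pos.le
    (Eventually.of_forall fun θ hθ => ?_)
    (((continuous_comp_cos hf').abs.mul continuous_sin).intervalIntegrable _ _)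
  rw [norm_mul, norm_mul, Real.norm_eq_abs, Real.norm_eq_abs, Real.norm_eq_abs,
    abs_of_nonneg (sin_nonneg_of_nonneg_of_le_pi hθ.1.le hθ.2)]
  exact mul_le_of_le_one_right
    (mul_nonneg (abs_nonneg _) (sin_nonneg_of_nonneg_of_le_pi hθ.1.le hθ.2)) (abs_sin_le_one _)

theorem abs_cosInt_le_descFactorial (p : ℕ) {f : ℝ → ℝ}
    (hf : ContDiffOn ℝ ((p + 1 : ℕ) : WithTop ℕ∞) f (Icc (-1) 1)) {k : ℕ} (hk : p + 1 ≤ k) :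
    |cosInt f k| ≤ (∫ t in (-1 : ℝ)..1, |iteratedDerivWithin (p + 1) f (Icc (-1) 1) t|) /
      k.descFactorial (p + 1) := by
  have hu : UniqueDiffOn ℝ (Icc (-1 : ℝ) 1) := uniqueDiffOn_Icc (by norm_num)
  induction p generalizing f k with
  | zero =>
    simp only [iteratedDerivWithin_succ', iteratedDerivWithin_zero, zero_add,
      Nat.descFactorial_one]
    exact abs_cosInt_le_integral_abs_derivWithin (by simpa using hf) (by omega)
  | succ p ih =>
    obtain ⟨k, rfl⟩ : ∃ m, k = m + 1 := ⟨k - 1, by omega⟩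
    rw [iteratedDerivWithin_succ']
    set V := ∫ t in (-1 : ℝ)..1,
      |iteratedDerivWithin (p + 1) (derivWithin f (Icc (-1) 1)) (Icc (-1) 1) t|
    have hV : 0 ≤ V := intervalIntegral.integral_nonneg (by norm_num) fun _ _ => abs_nonneg _
    have hf' : ContDiffOn ℝ ((p + 1 : ℕ) : WithTop ℕ∞) (derivWithin f (Icc (-1) 1))
      (Icc (-1) 1) := hf.derivWithin hu (by norm_cast)
    have h1 := ih hf' (k := k) (by omega)
    have h2 := ih hf' (k := k + 2) (by omega)
    have hpos : 0 < k.descFactorial (p + 1) := Nat.descFactorial_pos.2 (by omega)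
    -- The falling factorial increases with its base, so both terms of the recurrence are controlled
    -- by the one at `k`, and the factor `1/2` absorbs their sum.
    have h3 : V / (k + 2).descFactorial (p + 1) ≤ V / k.descFactorial (p + 1) := by
      gcongr
      omega
    rw [cosInt_succ_succ (hf.of_le (by norm_cast; omega)), abs_mul, abs_of_nonneg (by positivity),
      Nat.succ_descFactorial_succ, Nat.cast_mul, div_mul_eq_div_div_swap, one_div,
      ← div_eq_inv_mul]
    gcongr
    rw [abs_div, abs_two, div_le_iff₀ two_pos]
    have h4 := abs_sub (cosInt (derivWithin f (Icc (-1) 1)) k)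
      (cosInt (derivWithin f (Icc (-1) 1)) (k + 2))
    linarith

theorem sum_range_inv_descFactorial_le {p N : ℕ} (hp : 1 ≤ p) (hpN : p < N) (m : ℕ) :
    ∑ n ∈ Finset.range m, (1 : ℝ) / (n + (N + 1)).descFactorial (p + 1) ≤
      1 / (p * ((N : ℝ) - p) ^ p) := by
  -- Telescoping: the reciprocal falling factorial of order `p + 1` is `1/p` times a difference of
  -- consecutive reciprocals of order `p`.
  have hterm : ∀ n : ℕ, (1 : ℝ) / (n + (N + 1)).descFactorial (p + 1) =
      1 / p * (1 / (n + N).descFactorial p) - 1 / p * (1 / ((n + 1) + N).descFactorial p) := by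
    intro n
    have h1 : (n + (N + 1)).descFactorial (p + 1) = (n + N + 1) * (n + N).descFactorial p := by
      rw [← add_assoc, Nat.succ_descFactorial_succ]
    have h2 : (n + (N + 1)).descFactorial (p + 1) =
        (n + N + 1 - p) * ((n + 1) + N).descFactorial p := by
      rw [Nat.descFactorial_succ, show n + 1 + N = n + (N + 1) by ring, ← add_assoc]
    have hA : 0 < (n + N).descFactorial p := Nat.descFactorial_pos.2 (by omega)
    have hB : 0 < ((n + 1) + N).descFactorial p := Nat.descFactorial_pos.2 (by omega)
    set A := (n + N).descFactorial p
    set B := ((n + 1) + N).descFactorial p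
    have h3 : ((n : ℝ) + N + 1) * A = (n + N + 1 - p) * B := by
      have := h1.symm.trans h2
      have h4 : ((n + N + 1 - p : ℕ) : ℝ) = n + N + 1 - p := by
        rw [Nat.cast_sub (by omega)]; push_cast; ring
      rw [← h4]
      exact_mod_cast this
    rw [h1]
    have hA' : (0 : ℝ) < A := by exact_mod_cast hA
    have hB' : (0 : ℝ) < B := by exact_mod_cast hB
    have hp' : (0 : ℝ) < p := by exact_mod_cast hp
    push_cast
    field_simp
    linarith
  simp only [hterm]
  rw [Finset.sum_range_sub', zero_add]
  have h1 : (0 : ℝ) ≤ 1 / p * (1 / (m + N).descFactorial p) := by positivity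
  have h2 : ((N : ℝ) - p) ^ p ≤ N.descFactorial p := by
    have h3 := Nat.pow_sub_le_descFactorial N p
    have h4 : ((N : ℝ) - p) ^ p ≤ ((N + 1 - p : ℕ) : ℝ) ^ p := by
      have hNp : (p : ℝ) < N := by exact_mod_cast hpN
      refine pow_le_pow_left₀ (by linarith) ?_ _
      rw [Nat.cast_sub (by omega)]
      push_cast; linarith
    exact h4.trans (by exact_mod_cast h3)
  have hNp : (0 : ℝ) < N - p := by
    have : (p : ℝ) < N := by exact_mod_cast hpN
    linarith
  have hp' : (0 : ℝ) < p := by exact_mod_cast hp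
  calc _ ≤ 1 / p * (1 / (N.descFactorial p : ℝ)) := by linarith
    _ ≤ 1 / p * (1 / ((N : ℝ) - p) ^ p) := by gcongr
    _ = _ := by field_simp

/-- Pointwise convergence of the Fourier cosine series of `θ ↦ f (cos θ)`. -/
theorem hasSum_cosInt {f : ℝ → ℝ} (hf : ContinuousOn f (Icc (-1) 1)) (hs : Summable (cosInt f))
    (θ : ℝ) : HasSum (fun n : ℕ => (if n = 0 then 1 else 2) / π * cosInt f n * cos (n * θ))
      (f (cos θ)) := by
  have : Fact (0 < 2 * π) := ⟨by positivity⟩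
  have hper : Function.Periodic (fun θ => (f (cos θ) : ℂ)) (2 * π) := fun θ => by
    simp
  have hcont : Continuous fun θ => (f (cos θ) : ℂ) :=
    Complex.continuous_ofReal.comp (continuous_comp_cos hf)
  let F : C(AddCircle (2 * π), ℂ) := ⟨hper.lift, continuous_coinduced_dom.mpr hcont⟩
  have hFc : ∀ θ : ℝ, F (θ : AddCircle (2 * π)) = f (cos θ) := fun θ => rfl
  have hexp : ∀ (n : ℤ) (t : ℝ), fourier n (t : AddCircle (2 * π)) =
      Complex.exp (n * t * Complex.I) := by
    intro n t
    rw [fourier_coe_apply]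
    congr 1
    push_cast
    field_simp
  -- `F` is even: folding `[-π, 0]` onto `[0, π]` turns the exponentials into cosines.
  have hcoeff : ∀ n : ℤ, fourierCoeff F n = (1 / π * cosInt f n.natAbs : ℝ) := by
    intro n
    have hn : ∀ t : ℝ, cos (n.natAbs * t) = cos (n * t) := fun t => by
      rw [Nat.cast_natAbs, Int.cast_abs]
      rcases abs_choice (n : ℝ) with h | h <;> rw [h]
      rw [neg_mul, cos_neg]
    have hc : Continuous fun t : ℝ =>
        Complex.exp ((-n : ℤ) * t * Complex.I) * (f (cos t) : ℂ) := by fun_prop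
    have h1 : ∫ t in (-π)..0, Complex.exp ((-n : ℤ) * t * Complex.I) * (f (cos t) : ℂ) =
        ∫ t in (0)..π, Complex.exp ((-n : ℤ) * (-t : ℝ) * Complex.I) * (f (cos (-t)) : ℂ) := by
      rw [intervalIntegral.integral_comp_neg
        (fun t : ℝ => Complex.exp ((-n : ℤ) * t * Complex.I) * (f (cos t) : ℂ)), neg_zero]
    have hc' : Continuous fun t : ℝ =>
        Complex.exp ((-n : ℤ) * (-t : ℝ) * Complex.I) * (f (cos (-t)) : ℂ) := hc.comp continuous_neg
    rw [fourierCoeff_eq_intervalIntegral F n (-π), show -π + 2 * π = π by ring]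
    simp only [hFc, hexp, smul_eq_mul]
    rw [← intervalIntegral.integral_add_adjacent_intervals (b := 0) (hc.intervalIntegrable _ _)
      (hc.intervalIntegrable _ _), h1, ← intervalIntegral.integral_add
      (hc'.intervalIntegrable _ _) (hc.intervalIntegrable _ _)]
    have h2 : ∀ t : ℝ, Complex.exp ((-n : ℤ) * (-t : ℝ) * Complex.I) * (f (cos (-t)) : ℂ) +
        Complex.exp ((-n : ℤ) * t * Complex.I) * (f (cos t) : ℂ) =
        ((2 * (f (cos t) * cos (n.natAbs * t)) : ℝ) : ℂ) := by
      intro t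
      rw [hn, cos_neg]
      push_cast
      rw [show (2 : ℂ) * (f (cos t) * Complex.cos (n * t)) =
        2 * Complex.cos (n * t) * f (cos t) by ring, Complex.two_cos]
      ring_nf
    simp only [h2]
    rw [intervalIntegral.integral_ofReal, intervalIntegral.integral_const_mul, ← cosInt,
      Complex.real_smul, ← Complex.ofReal_mul]
    congr 1
    field_simp
  have hsum : Summable (fourierCoeff F) := by
    refine Summable.of_nat_of_neg ?_ ?_ <;>
    · simp only [hcoeff, Int.natAbs_neg, Int.natAbs_natCast]
      exact Complex.summable_ofReal.2 (hs.mul_left _)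
  have h1 := (has_pointwise_sum_fourier_series_of_summable hsum (θ : AddCircle (2 * π))).nat_add_neg
  -- Pairing `n` with `-n` counts the zeroth term twice; one copy is removed, hence `1/π` rather
  -- than `2/π` at `n = 0`.
  have h2 := h1.sub (hasSum_ite_eq 0 (fourierCoeff F 0 • fourier 0 (θ : AddCircle (2 * π))))
  rw [add_sub_cancel_right, hFc] at h2
  rw [← Complex.hasSum_ofReal]
  refine Eq.subst (motive := fun g => HasSum g ((f (cos θ) : ℝ) : ℂ)) (funext fun n => ?_) h2
  simp only [hcoeff, hexp, Int.natAbs_neg, Int.natAbs_natCast, smul_eq_mul]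
  have h3 := Complex.two_cos ((n : ℂ) * θ)
  rw [neg_mul] at h3
  rw [← mul_add, show ((-(n : ℤ) : ℤ) : ℂ) * θ * Complex.I = -((n : ℂ) * θ * Complex.I) by
    push_cast; ring, Int.cast_natCast, ← h3]
  split_ifs with hn
  · subst hn; simp; ring
  · push_cast; ring

end CosineCoefficients

/-! ### Chebyshev expansions on `[-R, R]`. -/

section Chebyshev

variable {R : ℝ} {p : ℕ} {f : ℝ → ℝ}

theorem chebCoeff_eq_cosInt (R : ℝ) (f : ℝ → ℝ) (n : ℕ) :
    chebCoeff R f n = (if n = 0 then 1 else 2) / Real.pi * cosInt (fun s => f (R * s)) n := rfl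

theorem contDiffOn_comp_mul (hR : 0 < R)
    (hf : ContDiffOn ℝ ((p + 1 : ℕ) : WithTop ℕ∞) f (Icc (-R) R)) :
    ContDiffOn ℝ ((p + 1 : ℕ) : WithTop ℕ∞) (fun s => f (R * s)) (Icc (-1) 1) :=
  hf.comp (contDiff_const.mul contDiff_id).contDiffOn fun s hs =>
    ⟨by nlinarith [hs.1, hs.2], by nlinarith [hs.1, hs.2]⟩

theorem div_mem_Icc (hR : 0 < R) {x : ℝ} (hx : x ∈ Icc (-R) R) : x / R ∈ Icc (-1 : ℝ) 1 := by
  rw [mem_Icc, le_div_iff₀ hR, div_le_iff₀ hR]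
  constructor <;> linarith [hx.1, hx.2]

theorem abs_chebT_le_one (hR : 0 < R) (n : ℕ) {x : ℝ} (hx : x ∈ Icc (-R) R) :
    |chebT R n x| ≤ 1 :=
  Polynomial.Chebyshev.abs_eval_T_real_le_one n (abs_le.2 (div_mem_Icc hR hx))

theorem continuous_chebT (R : ℝ) (n : ℕ) : Continuous (chebT R n) :=
  (Polynomial.continuous _).comp (continuous_id.div_const R)

theorem abs_chebCoeff_le (hR : 0 < R)
    (hf : ContDiffOn ℝ ((p + 1 : ℕ) : WithTop ℕ∞) f (Icc (-R) R)) {k : ℕ} (hk : p + 1 ≤ k) :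
    |chebCoeff R f k| ≤ 2 / Real.pi *
      (∫ t in (-1 : ℝ)..1, |iteratedDerivWithin (p + 1) (fun s => f (R * s)) (Icc (-1) 1) t|) *
        (1 / k.descFactorial (p + 1)) := by
  rw [chebCoeff_eq_cosInt, if_neg (by omega), abs_mul, abs_of_nonneg (by positivity), mul_assoc,
    mul_one_div]
  exact mul_le_mul_of_nonneg_left (abs_cosInt_le_descFactorial p (contDiffOn_comp_mul hR hf) hk)
    (by positivity)

theorem sum_range_abs_chebCoeff_le (hR : 0 < R) (hp : 1 ≤ p) {N : ℕ} (hpN : p < N)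
    (hf : ContDiffOn ℝ ((p + 1 : ℕ) : WithTop ℕ∞) f (Icc (-R) R)) (m : ℕ) :
    ∑ n ∈ Finset.range m, |chebCoeff R f (n + (N + 1))| ≤ 2 *
      (∫ t in (-1 : ℝ)..1, |iteratedDerivWithin (p + 1) (fun s => f (R * s)) (Icc (-1) 1) t|) /
        (Real.pi * p * ((N : ℝ) - p) ^ p) := by
  set V := ∫ t in (-1 : ℝ)..1,
    |iteratedDerivWithin (p + 1) (fun s => f (R * s)) (Icc (-1) 1) t|
  have hV : 0 ≤ V := intervalIntegral.integral_nonneg (by norm_num) fun _ _ => abs_nonneg _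
  calc _ ≤ ∑ n ∈ Finset.range m, 2 / Real.pi * V *
        (1 / (n + (N + 1)).descFactorial (p + 1)) :=
        Finset.sum_le_sum fun n _ => abs_chebCoeff_le hR hf (by omega)
    _ ≤ 2 / Real.pi * V * (1 / (p * ((N : ℝ) - p) ^ p)) := by
        rw [← Finset.mul_sum]
        exact mul_le_mul_of_nonneg_left (sum_range_inv_descFactorial_le hp hpN m)
          (by positivity)
    _ = _ := by rw [mul_one_div, div_mul_eq_mul_div, div_div]; ring_nf

/-- The tail bound at the smallest admissible truncation, `N = p + 1`. -/
theorem summable_abs_chebCoeff (hR : 0 < R) (hp : 1 ≤ p)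
    (hf : ContDiffOn ℝ ((p + 1 : ℕ) : WithTop ℕ∞) f (Icc (-R) R)) :
    Summable fun n => |chebCoeff R f n| :=
  (summable_nat_add_iff (p + 1 + 1)).1 (summable_of_sum_range_le (fun _ => abs_nonneg _)
    (sum_range_abs_chebCoeff_le hR hp (Nat.lt_succ_self p) hf))

/-- A function of class `C²` is the sum of its Chebyshev series. -/
theorem hasSum_chebCoeff (hR : 0 < R) (hp : 1 ≤ p)
    (hf : ContDiffOn ℝ ((p + 1 : ℕ) : WithTop ℕ∞) f (Icc (-R) R)) {x : ℝ}
    (hx : x ∈ Icc (-R) R) : HasSum (fun n => chebCoeff R f n * chebT R n x) (f x) := by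
  have hs : Summable (cosInt fun s => f (R * s)) := by
    refine Summable.of_norm_bounded ((summable_abs_chebCoeff hR hp hf).mul_left Real.pi)
      fun n => ?_
    rw [chebCoeff_eq_cosInt, abs_mul, ← mul_assoc, Real.norm_eq_abs]
    refine le_mul_of_one_le_left (abs_nonneg _) ?_
    rw [abs_of_nonneg (by positivity), mul_div_cancel₀ _ Real.pi_ne_zero]
    split_ifs <;> norm_num
  have hxR := div_mem_Icc hR hx
  have h1 := hasSum_cosInt (contDiffOn_comp_mul hR hf).continuousOn hs (Real.arccos (x / R))
  have h2 : ∀ n : ℕ, Real.cos (n * Real.arccos (x / R)) = chebT R n x := fun n => by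
    have h3 := Polynomial.Chebyshev.T_real_cos (Real.arccos (x / R)) n
    rw [Real.cos_arccos hxR.1 hxR.2] at h3
    rw [chebT, h3, Int.cast_natCast]
  rw [Real.cos_arccos hxR.1 hxR.2, mul_div_cancel₀ _ hR.ne'] at h1
  simpa only [h2, ← chebCoeff_eq_cosInt] using h1

/-- The truncated Chebyshev expansion. -/
def chebSum (R : ℝ) (f : ℝ → ℝ) (N : ℕ) (x : ℝ) : ℝ :=
  ∑ n ∈ Finset.range (N + 1), chebCoeff R f n * chebT R n x

theorem abs_sub_chebSum_le (hR : 0 < R) (hp : 1 ≤ p) {N : ℕ} (hpN : p < N)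
    (hf : ContDiffOn ℝ ((p + 1 : ℕ) : WithTop ℕ∞) f (Icc (-R) R)) {x : ℝ}
    (hx : x ∈ Icc (-R) R) : |f x - chebSum R f N x| ≤ 2 *
      (∫ t in (-1 : ℝ)..1, |iteratedDerivWithin (p + 1) (fun s => f (R * s)) (Icc (-1) 1) t|) /
        (Real.pi * p * ((N : ℝ) - p) ^ p) := by
  have h1 := hasSum_chebCoeff hR hp hf hx
  have h2 := (hasSum_nat_add_iff' (N + 1)).2 h1
  have h3 := (summable_nat_add_iff (N + 1)).2 (summable_abs_chebCoeff hR hp hf)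
  rw [chebSum, ← h2.tsum_eq, ← Real.norm_eq_abs]
  refine (tsum_of_norm_bounded h3.hasSum fun n => ?_).trans
    (h3.tsum_le_of_sum_range_le (sum_range_abs_chebCoeff_le hR hp hpN hf))
  rw [norm_mul]
  exact mul_le_of_le_one_right (abs_nonneg _) (abs_chebT_le_one hR _ hx)

end Chebyshev

/-! ### Differences of finite products. -/

section Products

variable {ι : Type*}

theorem abs_prod_sub_prod_le_sum {a b : ι → ℝ} (s : Finset ι) (ha : ∀ i ∈ s, |a i| ≤ 1)
    (hb : ∀ i ∈ s, |b i| ≤ 1) :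
    |∏ i ∈ s, a i - ∏ i ∈ s, b i| ≤ ∑ i ∈ s, |a i - b i| := by
  classical
  induction s using Finset.induction_on with
  | empty => simp
  | insert i s hi ih =>
    rw [Finset.prod_insert hi, Finset.prod_insert hi, Finset.sum_insert hi]
    have h1 := ih (fun j hj => ha j (Finset.mem_insert_of_mem hj))
      (fun j hj => hb j (Finset.mem_insert_of_mem hj))
    have h2 : |∏ j ∈ s, a j| ≤ 1 := by
      rw [Finset.abs_prod]
      exact Finset.prod_le_one (fun _ _ => abs_nonneg _)
        fun j hj => ha j (Finset.mem_insert_of_mem hj)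
    have h3 := hb i (Finset.mem_insert_self _ _)
    calc |a i * ∏ j ∈ s, a j - b i * ∏ j ∈ s, b j|
        = |(a i - b i) * ∏ j ∈ s, a j + b i * (∏ j ∈ s, a j - ∏ j ∈ s, b j)| := by ring_nf
      _ ≤ |a i - b i| * |∏ j ∈ s, a j| + |b i| * |∏ j ∈ s, a j - ∏ j ∈ s, b j| := by
        rw [← abs_mul, ← abs_mul]; exact abs_add_le _ _
      _ ≤ |a i - b i| * 1 + 1 * ∑ j ∈ s, |a j - b j| := by gcongr
      _ = _ := by ring

theorem abs_prod_sub_prod_le_card {a b : ι → ℝ} {A ε : ℝ} (hA : 0 ≤ A) (hε : 0 ≤ ε)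
    (s : Finset ι) (ha : ∀ i ∈ s, |a i| ≤ A) (hb : ∀ i ∈ s, |b i| ≤ A)
    (hab : ∀ i ∈ s, |a i - b i| ≤ ε) :
    |∏ i ∈ s, a i - ∏ i ∈ s, b i| ≤ s.card * ε * A ^ (s.card - 1) := by
  classical
  induction s using Finset.induction_on with
  | empty => simp
  | insert i s hi ih =>
    rw [Finset.prod_insert hi, Finset.prod_insert hi, Finset.card_insert_of_notMem hi]
    have h1 := ih (fun j hj => ha j (Finset.mem_insert_of_mem hj))
      (fun j hj => hb j (Finset.mem_insert_of_mem hj))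
      (fun j hj => hab j (Finset.mem_insert_of_mem hj))
    have h2 : |∏ j ∈ s, a j| ≤ A ^ s.card := by
      rw [Finset.abs_prod]
      refine (Finset.prod_le_prod (fun _ _ => abs_nonneg _)
        fun j hj => ha j (Finset.mem_insert_of_mem hj)).trans (le_of_eq ?_)
      rw [Finset.prod_const]
    have h3 := hb i (Finset.mem_insert_self _ _)
    have h4 := hab i (Finset.mem_insert_self _ _)
    calc |a i * ∏ j ∈ s, a j - b i * ∏ j ∈ s, b j|
        = |(a i - b i) * ∏ j ∈ s, a j + b i * (∏ j ∈ s, a j - ∏ j ∈ s, b j)| := by ring_nf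
      _ ≤ |a i - b i| * |∏ j ∈ s, a j| + |b i| * |∏ j ∈ s, a j - ∏ j ∈ s, b j| := by
        rw [← abs_mul, ← abs_mul]; exact abs_add_le _ _
      _ ≤ ε * A ^ s.card + A * (s.card * ε * A ^ (s.card - 1)) := by gcongr
      _ = _ := by
        rcases Nat.eq_zero_or_pos s.card with h0 | h0
        · simp [h0]
        · obtain ⟨k, hk⟩ : ∃ k, s.card = k + 1 := ⟨s.card - 1, by omega⟩
          rw [hk]; push_cast; ring

end Products

/-! ### Combinatorics of the chain `0, x_1, …, x_d, 0`. -/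

section Chain

variable {d : ℕ}

@[simp] theorem chain_zero (x : Fin d → ℝ) : chain x 0 = 0 := rfl

@[simp] theorem chain_succ_castSucc (x : Fin d → ℝ) (i : Fin d) :
    chain x i.succ.castSucc = x i := by
  rw [← Fin.succ_castSucc, chain, Fin.cons_succ, Fin.snoc_castSucc]

@[simp] theorem chain_castSucc_succ (x : Fin d → ℝ) (i : Fin d) :
    chain x i.castSucc.succ = x i := by
  rw [chain, Fin.cons_succ, Fin.snoc_castSucc]

@[simp] theorem chain_last (x : Fin d → ℝ) : chain x (Fin.last (d + 1)) = 0 := by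
  rw [← Fin.succ_last, chain, Fin.cons_succ, Fin.snoc_last]

theorem continuous_chain (k : Fin (d + 2)) : Continuous fun x : Fin d → ℝ => chain x k := by
  induction k using Fin.cases with
  | zero => exact (continuous_const : Continuous fun _ : Fin d → ℝ => (0 : ℝ))
  | succ k =>
    induction k using Fin.lastCases with
    | last => simpa using (continuous_const : Continuous fun _ : Fin d → ℝ => (0 : ℝ))
    | cast i => simpa using (continuous_apply i : Continuous fun x : Fin d → ℝ => x i)

theorem prod_chain_castSucc (r : Fin (d + 1) → ℝ → ℝ) (x : Fin d → ℝ) :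
    ∏ k : Fin (d + 1), r k (chain x k.castSucc) = r 0 0 * ∏ i : Fin d, r i.succ (x i) := by
  rw [Fin.prod_univ_succ]; simp

theorem prod_chain_succ (r : Fin (d + 1) → ℝ → ℝ) (x : Fin d → ℝ) :
    ∏ k : Fin (d + 1), r k (chain x k.succ) =
      (∏ i : Fin d, r i.castSucc (x i)) * r (Fin.last d) 0 := by
  rw [Fin.prod_univ_castSucc]; simp

/-- Each link of the chain contains a coordinate that does not occur at its other end. -/
theorem exists_chain_update (hd : 1 ≤ d) (D : ℝ → ℝ → ℝ) (hD : ∀ x y, D x y = D y x)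
    (k : Fin (d + 1)) : ∃ i : Fin d, ∀ x : Fin d → ℝ, ∃ y, ∀ t,
      D (chain (Function.update x i t) k.castSucc) (chain (Function.update x i t) k.succ) =
        D y t := by
  induction k using Fin.lastCases with
  | last =>
    obtain ⟨e, rfl⟩ : ∃ e, d = e + 1 := ⟨d - 1, by omega⟩
    refine ⟨Fin.last e, fun x => ⟨0, fun t => ?_⟩⟩
    rw [Fin.succ_last, chain_last, ← Fin.succ_last, chain_succ_castSucc, Function.update_self, hD]
  | cast i =>
    refine ⟨i, fun x => ⟨chain x i.castSucc.castSucc, fun t => ?_⟩⟩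
    rw [chain_castSucc_succ, Function.update_self]
    congr 1
    obtain ⟨e, rfl⟩ : ∃ e, d = e + 1 := ⟨d - 1, by omega⟩
    induction i using Fin.cases with
    | zero => rfl
    | succ j =>
      rw [← Fin.succ_castSucc, chain_succ_castSucc, chain_succ_castSucc,
        Function.update_of_ne (Fin.castSucc_lt_succ).ne]

end Chain

/-! ### Stability of chain integrals over the cube. -/

section Cube

variable {d : ℕ} {R : ℝ}

/-- The cube `[-R, R]^d`. -/
abbrev cube (d : ℕ) (R : ℝ) : Set (Fin d → ℝ) := univ.pi fun _ => Icc (-R) R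

theorem isCompact_cube : IsCompact (cube d R) := isCompact_univ_pi fun _ => isCompact_Icc

theorem measurableSet_cube : MeasurableSet (cube d R) :=
  MeasurableSet.univ_pi fun _ => measurableSet_Icc

theorem restrict_cube : (volume : Measure (Fin d → ℝ)).restrict (cube d R) =
    Measure.pi fun _ => muI R := by
  rw [volume_pi, Measure.restrict_pi_pi]

/-- Integrating over coordinate `i` first gives at most `δ`; the other `d - 1` coordinates
contribute the volume. This is carried out by comparing marginals with the constant `δ / (2R)`. -/
theorem integral_abs_le_of_integral_update_le (hR : 0 < R) {G : (Fin d → ℝ) → ℝ}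
    (hG : Continuous G) {δ : ℝ} (i : Fin d)
    (h : ∀ x, ∫ t, |G (Function.update x i t)| ∂(muI R) ≤ δ) :
    ∫ x in cube d R, |G x| ≤ (2 * R) ^ (d - 1) * δ := by
  have hδ : 0 ≤ δ := (integral_nonneg fun _ => abs_nonneg _).trans (h 0)
  have huniv : muI R univ = ENNReal.ofReal (2 * R) := by
    rw [← muI_real_univ hR, ofReal_measureReal]
  have h1 : ∫⁻ x, ‖G x‖ₑ ∂(Measure.pi fun _ : Fin d => muI R) ≤
      ∫⁻ _, ENNReal.ofReal (δ / (2 * R)) ∂(Measure.pi fun _ : Fin d => muI R) := by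
    refine lintegral_le_of_lmarginal_le {i} hG.enorm.measurable measurable_const fun x => ?_
    rw [lmarginal_singleton, lmarginal_singleton, lintegral_const, huniv,
      ← ENNReal.ofReal_mul (by positivity), div_mul_cancel₀ _ (by positivity)]
    have hcont : Continuous fun t => G (Function.update x i t) :=
      hG.comp (continuous_const.update i continuous_id)
    have hint : Integrable (fun t => G (Function.update x i t)) (muI R) :=
      hcont.continuousOn.integrableOn_Icc
    have h2 := ofReal_integral_norm_eq_lintegral_enorm hint
    refine (le_of_eq h2.symm).trans ?_
    exact ENNReal.ofReal_le_ofReal (h x)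
  rw [lintegral_const, Measure.pi_univ, Finset.prod_const, Finset.card_univ, Fintype.card_fin,
    huniv, ← ENNReal.ofReal_pow (by positivity), ← ENNReal.ofReal_mul (by positivity)] at h1
  have h3 : ∫ x in cube d R, |G x| = (∫⁻ x, ‖G x‖ₑ ∂(Measure.pi fun _ : Fin d => muI R)).toReal := by
    rw [← restrict_cube, ← integral_norm_eq_lintegral_enorm hG.aestronglyMeasurable]
    rfl
  rw [h3]
  refine (ENNReal.toReal_mono ENNReal.ofReal_ne_top h1).trans (le_of_eq ?_)
  rw [ENNReal.toReal_ofReal (by positivity)]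
  obtain ⟨e, rfl⟩ : ∃ e, d = e + 1 := ⟨d - 1, by have := i.pos; omega⟩
  rw [Nat.add_sub_cancel, pow_succ]
  field_simp

theorem integrableOn_chain {k : ℝ → ℝ → ℝ} (hk : Continuous (Function.uncurry k))
    {ψ : Fin d → ℝ → ℝ} (hψ : ∀ i, Continuous (ψ i)) :
    IntegrableOn (fun x : Fin d → ℝ =>
      (∏ m : Fin (d + 1), k (chain x m.castSucc) (chain x m.succ)) * ∏ i, ψ i (x i))
      (cube d R) := by
  refine ContinuousOn.integrableOn_compact isCompact_cube (Continuous.continuousOn ?_)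
  exact (continuous_finsetProd _ fun (m : Fin (d + 1)) _ =>
    hk.comp ((continuous_chain m.castSucc).prodMk (continuous_chain m.succ))).mul
    (continuous_finsetProd _ fun i _ => (hψ i).comp (continuous_apply i))

/-- Effect on the chain integral of replacing the kernel. -/
theorem abs_integral_chain_sub_kernel_le (hR : 0 < R) (hd : 1 ≤ d) {k k' : ℝ → ℝ → ℝ}
    (hk : Continuous (Function.uncurry k)) (hk' : Continuous (Function.uncurry k'))
    (hsymm : ∀ x y, k x y = k y x) (hsymm' : ∀ x y, k' x y = k' y x)
    (hk1 : ∀ x y, |k x y| ≤ 1) (hk1' : ∀ x y, |k' x y| ≤ 1) {δ : ℝ}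
    (hδ : ∀ x, ∫ t, |k x t - k' x t| ∂(muI R) ≤ δ) {ψ : Fin d → ℝ → ℝ}
    (hψ : ∀ i, Continuous (ψ i)) {B : Fin d → ℝ} (hB : ∀ i x, |ψ i x| ≤ B i) :
    |(∫ x in cube d R, (∏ m : Fin (d + 1), k (chain x m.castSucc) (chain x m.succ)) *
        ∏ i, ψ i (x i)) -
      ∫ x in cube d R, (∏ m : Fin (d + 1), k' (chain x m.castSucc) (chain x m.succ)) *
        ∏ i, ψ i (x i)| ≤ (d + 1) * (2 * R) ^ (d - 1) * δ * ∏ i, B i := by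
  have hkm : ∀ m : Fin (d + 1), Continuous fun x : Fin d → ℝ =>
      k (chain x m.castSucc) (chain x m.succ) := fun m =>
    hk.comp ((continuous_chain m.castSucc).prodMk (continuous_chain m.succ))
  have hkm' : ∀ m : Fin (d + 1), Continuous fun x : Fin d → ℝ =>
      k' (chain x m.castSucc) (chain x m.succ) := fun m =>
    hk'.comp ((continuous_chain m.castSucc).prodMk (continuous_chain m.succ))
  have hint : ∀ G : (Fin d → ℝ) → ℝ, Continuous G → IntegrableOn G (cube d R) := fun G hG =>
    hG.continuousOn.integrableOn_compact isCompact_cube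
  have hB0 : 0 ≤ ∏ i, B i :=
    Finset.prod_nonneg fun i _ => (abs_nonneg _).trans (hB i 0)
  rw [← integral_sub (integrableOn_chain hk hψ) (integrableOn_chain hk' hψ), ← Real.norm_eq_abs]
  have h1 : ∀ x : Fin d → ℝ,
      ‖(∏ m : Fin (d + 1), k (chain x m.castSucc) (chain x m.succ)) * ∏ i, ψ i (x i) -
        (∏ m : Fin (d + 1), k' (chain x m.castSucc) (chain x m.succ)) * ∏ i, ψ i (x i)‖ ≤
      (∑ m : Fin (d + 1), |k (chain x m.castSucc) (chain x m.succ) -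
        k' (chain x m.castSucc) (chain x m.succ)|) * ∏ i, B i := by
    intro x
    rw [← sub_mul, norm_mul, Real.norm_eq_abs, Real.norm_eq_abs]
    refine mul_le_mul (abs_prod_sub_prod_le_sum _ (fun m _ => hk1 _ _) fun m _ => hk1' _ _) ?_
      (abs_nonneg _) (Finset.sum_nonneg fun _ _ => abs_nonneg _)
    rw [Finset.abs_prod]
    exact Finset.prod_le_prod (fun _ _ => abs_nonneg _) fun i _ => hB i _
  have hDint : ∀ m : Fin (d + 1), IntegrableOn (fun x : Fin d → ℝ =>
      |k (chain x m.castSucc) (chain x m.succ) - k' (chain x m.castSucc) (chain x m.succ)|)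
      (cube d R) := fun m => hint _ ((hkm m).sub (hkm' m)).abs
  refine (norm_integral_le_of_norm_le ((integrable_finsetSum _ fun m _ => hDint m).mul_const _)
    (Eventually.of_forall h1)).trans ?_
  rw [integral_mul_const, integral_finsetSum _ fun m _ => hDint m]
  refine mul_le_mul_of_nonneg_right ?_ hB0
  -- Each link is integrated first in a coordinate occurring at only one of its ends, where the
  -- one-variable bound `hδ` applies uniformly in the other end.
  have h2 : ∀ m : Fin (d + 1), ∫ x in cube d R,
      |k (chain x m.castSucc) (chain x m.succ) - k' (chain x m.castSucc) (chain x m.succ)| ≤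
        (2 * R) ^ (d - 1) * δ := by
    intro m
    obtain ⟨i, hi⟩ := exists_chain_update hd (fun x y => k x y - k' x y)
      (fun x y => by rw [hsymm, hsymm']) m
    refine integral_abs_le_of_integral_update_le hR ((hkm m).sub (hkm' m)) i fun x => ?_
    obtain ⟨y, hy⟩ := hi x
    exact (integral_congr_ae (Eventually.of_forall fun t => congrArg abs (hy t))).trans_le (hδ y)
  refine (Finset.sum_le_sum fun m _ => h2 m).trans (le_of_eq ?_)
  simp
  ring

/-- Effect on the chain integral of replacing the functions `ψ i`. -/
theorem abs_integral_chain_sub_factor_le {k : ℝ → ℝ → ℝ}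
    (hk : Continuous (Function.uncurry k)) {r : ℝ → ℝ} (hr : Continuous r)
    (hkr : ∀ x y, |k x y| ≤ r x * r y) {ψ ψ' : Fin d → ℝ → ℝ}
    (hψ : ∀ i, Continuous (ψ i)) (hψ' : ∀ i, Continuous (ψ' i)) {m ε : ℝ} (hm : 0 ≤ m)
    (hε : 0 ≤ ε) (hψm : ∀ i x, |ψ i x| ≤ m) (hψε : ∀ i x, |ψ i x - ψ' i x| ≤ ε) :
    |(∫ x in cube d R, (∏ m : Fin (d + 1), k (chain x m.castSucc) (chain x m.succ)) *
        ∏ i, ψ i (x i)) -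
      ∫ x in cube d R, (∏ m : Fin (d + 1), k (chain x m.castSucc) (chain x m.succ)) *
        ∏ i, ψ' i (x i)| ≤
      d * ε * (m + ε) ^ (d - 1) * (r 0 ^ 2 * (∫ x, r x ^ 2 ∂(muI R)) ^ d) := by
  rw [← integral_sub (integrableOn_chain hk hψ) (integrableOn_chain hk hψ'), ← Real.norm_eq_abs]
  have hψm' : ∀ i x, |ψ' i x| ≤ m + ε := fun i x => by
    have h1 := abs_le.1 (hψm i x)
    have h2 := abs_le.1 (hψε i x)
    exact abs_le.2 ⟨by linarith, by linarith⟩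
  have h1 : ∀ x : Fin d → ℝ,
      ‖(∏ m : Fin (d + 1), k (chain x m.castSucc) (chain x m.succ)) * ∏ i, ψ i (x i) -
        (∏ m : Fin (d + 1), k (chain x m.castSucc) (chain x m.succ)) * ∏ i, ψ' i (x i)‖ ≤
      d * ε * (m + ε) ^ (d - 1) * r 0 ^ 2 * ∏ i, r (x i) ^ 2 := by
    intro x
    -- Every interior point of the chain belongs to two links, and so does `0` (the first and the
    -- last), so all factors of `r` appear squared.
    have h2 : |∏ m : Fin (d + 1), k (chain x m.castSucc) (chain x m.succ)| ≤
        r 0 ^ 2 * ∏ i, r (x i) ^ 2 := by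
      rw [Finset.abs_prod]
      refine (Finset.prod_le_prod (fun _ _ => abs_nonneg _) fun m _ => hkr _ _).trans
        (le_of_eq ?_)
      rw [Finset.prod_mul_distrib, prod_chain_castSucc fun _ => r, prod_chain_succ fun _ => r,
        Finset.prod_pow]
      ring
    have h3 := abs_prod_sub_prod_le_card (a := fun i => ψ i (x i)) (b := fun i => ψ' i (x i))
      (A := m + ε) (by positivity) hε Finset.univ
      (fun i _ => (hψm i _).trans (by linarith)) (fun i _ => hψm' i _) fun i _ => hψε i _
    rw [Finset.card_univ, Fintype.card_fin] at h3
    rw [← mul_sub, norm_mul, Real.norm_eq_abs, Real.norm_eq_abs, mul_comm, mul_assoc]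
    exact mul_le_mul h3 h2 (abs_nonneg _) (by positivity)
  have hrc : Continuous fun x : Fin d → ℝ => ∏ i, r (x i) ^ 2 :=
    continuous_finsetProd _ fun i _ => (hr.comp (continuous_apply i)).pow 2
  refine (norm_integral_le_of_norm_le
    ((hrc.continuousOn.integrableOn_compact isCompact_cube).const_mul _)
    (Eventually.of_forall h1)).trans (le_of_eq ?_)
  rw [integral_const_mul, restrict_cube, integral_fintype_prod_eq_pow (fun x => r x ^ 2),
    Fintype.card_fin]
  ring

end Cube

/-! ### The truncated functional as a chain integral. -/

section Truncation

variable {d : ℕ} {lam h R : ℝ} {ev : ℕ → ℝ} {u : ℕ → ℝ → ℝ}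

theorem coefA_eq_integral (hR : 0 < R) (ev : ℕ → ℝ) (u : ℕ → ℝ → ℝ) (j l : ℕ) (f : ℝ → ℝ) :
    coefA R ev u j l f = ∫ x, vFun ev u j x * vFun ev u l x * f x ∂(muI R) := by
  rw [coefA, intervalIntegral.integral_of_le (by linarith), integral_Icc_eq_integral_Ioc]

/-- One summation index per link and one per function; regrouping the factors by points of the chain
instead of links collects the integrand of one `coefA` at each `x i`. -/
theorem prod_mercerSum_mul_prod_chebSum (ev : ℕ → ℝ) (u : ℕ → ℝ → ℝ) (R : ℝ) (J N : ℕ)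
    (phi : Fin d → ℝ → ℝ) (x : Fin d → ℝ) :
    (∏ m : Fin (d + 1), mercerSum ev u J (chain x m.castSucc) (chain x m.succ)) *
        ∏ i, chebSum R (phi i) N (x i) =
      ∑ j : Fin (d + 1) → Fin J, ∑ n : Fin d → Fin (N + 1),
        (vFun ev u (j 0) 0 * vFun ev u (j (Fin.last d)) 0 * ∏ i, chebCoeff R (phi i) (n i)) *
          ∏ i : Fin d, vFun ev u (j i.castSucc) (x i) * vFun ev u (j i.succ) (x i) *
            chebT R (n i) (x i) := by
  have h1 : ∏ m : Fin (d + 1), mercerSum ev u J (chain x m.castSucc) (chain x m.succ) =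
      ∑ j : Fin (d + 1) → Fin J, ∏ m : Fin (d + 1),
        vFun ev u (j m) (chain x m.castSucc) * vFun ev u (j m) (chain x m.succ) := by
    simp only [mercerSum, Finset.sum_range]
    rw [Finset.prod_univ_sum, Fintype.piFinset_univ]
  have h2 : ∏ i, chebSum R (phi i) N (x i) =
      ∑ n : Fin d → Fin (N + 1), ∏ i, chebCoeff R (phi i) (n i) * chebT R (n i) (x i) := by
    simp only [chebSum, Finset.sum_range]
    rw [Finset.prod_univ_sum, Fintype.piFinset_univ]
  rw [h1, h2, Finset.sum_mul_sum]
  refine Finset.sum_congr rfl fun j _ => Finset.sum_congr rfl fun n _ => ?_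
  rw [Finset.prod_mul_distrib, prod_chain_castSucc fun m => vFun ev u (j m),
    prod_chain_succ fun m => vFun ev u (j m), Finset.prod_mul_distrib, Finset.prod_mul_distrib,
    Finset.prod_mul_distrib]
  ring

theorem funcHTrunc_eq_integral (hR : 0 < R) (hu : IsEigendecomposition lam h R ev u) (J N : ℕ)
    (phi : Fin d → ℝ → ℝ) : funcHTrunc lam R ev u J N phi = cLam lam * ∫ x in cube d R,
      (∏ m : Fin (d + 1), mercerSum ev u J (chain x m.castSucc) (chain x m.succ)) *
        ∏ i, chebSum R (phi i) N (x i) := by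
  have hint : ∀ (j : Fin (d + 1) → Fin J) (n : Fin d → Fin (N + 1)), IntegrableOn
      (fun x : Fin d → ℝ => (vFun ev u (j 0) 0 * vFun ev u (j (Fin.last d)) 0 *
        ∏ i, chebCoeff R (phi i) (n i)) *
          ∏ i : Fin d, vFun ev u (j i.castSucc) (x i) * vFun ev u (j i.succ) (x i) *
            chebT R (n i) (x i)) (cube d R) := by
    intro j n
    refine Integrable.const_mul ?_ _
    rw [restrict_cube]
    refine Integrable.fintype_prod (f := fun (i : Fin d) y => vFun ev u (j i.castSucc) y *
      vFun ev u (j i.succ) y * chebT R (n i) y) fun i => ?_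
    exact (((continuousOn_vFun hu _).mul (continuousOn_vFun hu _)).mul
      (continuous_chebT R _).continuousOn).integrableOn_Icc
  simp only [prod_mercerSum_mul_prod_chebSum]
  rw [integral_finsetSum _ fun j _ => integrable_finsetSum _ fun n _ => hint j n, funcHTrunc]
  congr 1
  refine Finset.sum_congr rfl fun j _ => ?_
  rw [integral_finsetSum _ fun n _ => hint j n]
  refine Finset.sum_congr rfl fun n _ => ?_
  rw [integral_const_mul, restrict_cube, integral_fintype_prod_eq_prod
    (fun (i : Fin d) y => vFun ev u (j i.castSucc) y * vFun ev u (j i.succ) y * chebT R (n i) y)]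
  simp only [← coefA_eq_integral hR]
  ring

end Truncation

/-! ### Pointwise control by the norms in the statement. -/

section SupNorm

variable {R : ℝ} {f : ℝ → ℝ}

theorem abs_le_supNorm (hR : 0 < R) (hf : ContinuousOn f (Icc (-R) R)) {x : ℝ}
    (hx : x ∈ Icc (-R) R) : |f x| ≤ supNorm R f := by
  have hmem : MemLp f ∞ (muI R) := by
    obtain ⟨C, hC⟩ := isCompact_Icc.exists_bound_of_continuousOn hf
    refine MemLp.of_bound (hf.aestronglyMeasurable measurableSet_Icc) C ?_
    filter_upwards [ae_restrict_mem measurableSet_Icc] with x hx using hC x hx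
  -- The a.e. bound is rewritten as an a.e. equality of continuous functions, which then holds
  -- everywhere on the interval.
  have h1 : (fun x => min |f x| (supNorm R f)) =ᵐ[muI R] fun x => |f x| := by
    filter_upwards [ae_le_lpNorm_exponent_top hmem] with y hy
    exact min_eq_left hy
  have h2 := Measure.eqOn_Icc_of_ae_eq (volume : Measure ℝ) (by linarith : -R ≠ R) h1
    (continuous_min.comp_continuousOn (hf.abs.prodMk continuousOn_const)) hf.abs hx
  exact min_eq_left_iff.1 h2

theorem supNorm_le_maxSupNorm {d : ℕ} (phi : Fin d → ℝ → ℝ) (i : Fin d) :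
    supNorm R (phi i) ≤ maxSupNorm R phi :=
  le_ciSup (f := fun i => supNorm R (phi i)) (finite_range _).bddAbove i

theorem le_chebTail {d p N : ℕ} (hpN : p < N) (phi : Fin d → ℝ → ℝ) (i : Fin d) :
    2 * (∫ t in (-1 : ℝ)..1,
      |iteratedDerivWithin (p + 1) (fun s => phi i (R * s)) (Icc (-1) 1) t|) /
        (Real.pi * p * ((N : ℝ) - p) ^ p) ≤ chebTail R p N phi := by
  have hNp : (0 : ℝ) ≤ N - p := by
    have : (p : ℝ) < N := by exact_mod_cast hpN
    linarith
  have h1 : (∫ t in (-1 : ℝ)..1,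
      |iteratedDerivWithin (p + 1) (fun s => phi i (R * s)) (Icc (-1) 1) t|) ≤ Vp R p phi :=
    le_ciSup (f := fun i => ∫ t in (-1 : ℝ)..1,
      |iteratedDerivWithin (p + 1) (fun s => phi i (R * s)) (Icc (-1) 1) t|)
      (finite_range _).bddAbove i
  unfold chebTail
  have := Real.pi_pos
  gcongr

end SupNorm

/-! ### Extension from `[-R, R]` to the line. -/

section Clamp

variable {R : ℝ}

/-- The nearest-point projection onto `[-R, R]`. -/
def clamp (R x : ℝ) : ℝ := max (-R) (min x R)

theorem continuous_clamp (R : ℝ) : Continuous (clamp R) := by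
  unfold clamp; fun_prop

theorem clamp_mem (hR : 0 < R) (x : ℝ) : clamp R x ∈ Icc (-R) R :=
  ⟨le_max_left _ _, max_le (by linarith) (min_le_right _ _)⟩

theorem clamp_of_mem {x : ℝ} (hx : x ∈ Icc (-R) R) : clamp R x = x := by
  rw [clamp, min_eq_left hx.2, max_eq_right hx.1]

theorem chain_mem {d : ℕ} (hR : 0 < R) {x : Fin d → ℝ} (hx : x ∈ cube d R) (k : Fin (d + 2)) :
    chain x k ∈ Icc (-R) R := by
  have h0 : (0 : ℝ) ∈ Icc (-R) R := ⟨by linarith, hR.le⟩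
  induction k using Fin.cases with
  | zero => exact h0
  | succ k =>
    induction k using Fin.lastCases with
    | last => simpa using h0
    | cast i => rw [chain_castSucc_succ]; exact hx i (mem_univ _)

/-- Composing with `clamp` makes functions continuous only on `[-R, R]` globally continuous, with
the same bounds, as the stability lemmas require, and does not change the integral. -/
theorem setIntegral_chain_clamp {d : ℕ} (hR : 0 < R) (k : ℝ → ℝ → ℝ) (ψ : Fin d → ℝ → ℝ) :
    ∫ x in cube d R, (∏ m : Fin (d + 1), k (chain x m.castSucc) (chain x m.succ)) *
        ∏ i, ψ i (x i) =
      ∫ x in cube d R, (∏ m : Fin (d + 1),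
        k (clamp R (chain x m.castSucc)) (clamp R (chain x m.succ))) *
          ∏ i, ψ i (clamp R (x i)) := by
  refine setIntegral_congr_fun measurableSet_cube fun x hx => ?_
  have h1 : ∀ i, clamp R (x i) = x i := fun i => clamp_of_mem (hx i (mem_univ _))
  simp only [clamp_of_mem (chain_mem hR hx _), h1]

theorem integral_clamp (f : ℝ → ℝ) : ∫ x, f (clamp R x) ∂(muI R) = ∫ x, f x ∂(muI R) :=
  setIntegral_congr_fun measurableSet_Icc fun x hx => by
    simp only [clamp_of_mem hx]

end Clamp

/-! ### The error estimate. -/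

section Main

variable {d : ℕ} {lam h R : ℝ} {ev : ℕ → ℝ} {u : ℕ → ℝ → ℝ}

theorem mercerSum_comm (ev : ℕ → ℝ) (u : ℕ → ℝ → ℝ) (J : ℕ) (x y : ℝ) :
    mercerSum ev u J x y = mercerSum ev u J y x :=
  Finset.sum_congr rfl fun _ _ => mul_comm _ _

theorem mercerSum_self_nonneg (ev : ℕ → ℝ) (u : ℕ → ℝ → ℝ) (J : ℕ) (x : ℝ) :
    0 ≤ mercerSum ev u J x x :=
  Finset.sum_nonneg fun _ _ => mul_self_nonneg _

theorem abs_mercerSum_le (ev : ℕ → ℝ) (u : ℕ → ℝ → ℝ) (J : ℕ) (x y : ℝ) :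
    |mercerSum ev u J x y| ≤
      Real.sqrt (mercerSum ev u J x x) * Real.sqrt (mercerSum ev u J y y) := by
  rw [← Real.sqrt_mul (mercerSum_self_nonneg ev u J x)]
  refine Real.abs_le_sqrt ?_
  have := Finset.sum_mul_sq_le_sq_mul_sq (Finset.range J) (fun j => vFun ev u j x)
    fun j => vFun ev u j y
  simpa only [mercerSum, ← sq] using this

theorem continuous_mercerSum_clamp (hR : 0 < R) (hu : IsEigendecomposition lam h R ev u) (J : ℕ) :
    Continuous (Function.uncurry fun x y => mercerSum ev u J (clamp R x) (clamp R y)) := by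
  have hv : ∀ j, Continuous fun x => vFun ev u j (clamp R x) := fun j =>
    (continuousOn_vFun hu j).comp_continuous (continuous_clamp R) (clamp_mem hR)
  have h1 : Continuous fun z : ℝ × ℝ => ∑ j ∈ Finset.range J,
      vFun ev u j (clamp R z.1) * vFun ev u j (clamp R z.2) :=
    continuous_finsetSum _ fun j _ =>
      ((hv j).comp continuous_fst).mul ((hv j).comp continuous_snd)
  exact h1

theorem continuous_kernel_clamp (lam h R : ℝ) :
    Continuous (Function.uncurry fun x y => kernel lam h (clamp R x) (clamp R y)) := by
  have h1 : Continuous fun z : ℝ × ℝ => (clamp R z.1, clamp R z.2) :=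
    ((continuous_clamp R).comp continuous_fst).prodMk ((continuous_clamp R).comp continuous_snd)
  simpa only [Function.comp_def, Function.uncurry_def] using (continuous_kernel lam h).comp h1

theorem continuous_chebSum (R : ℝ) (f : ℝ → ℝ) (N : ℕ) : Continuous (chebSum R f N) := by
  have h1 : Continuous fun x => ∑ n ∈ Finset.range (N + 1), chebCoeff R f n * chebT R n x :=
    continuous_finsetSum _ fun n _ => continuous_const.mul (continuous_chebT R n)
  exact h1

theorem abs_mercerSum_le_one (hlam : 0 < lam) (hh : 0 < h) (hR : 0 < R)
    (hu : IsEigendecomposition lam h R ev u) (J : ℕ) {x y : ℝ} (hx : x ∈ Icc (-R) R)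
    (hy : y ∈ Icc (-R) R) : |mercerSum ev u J x y| ≤ 1 := by
  have h1 : ∀ z ∈ Icc (-R) R, Real.sqrt (mercerSum ev u J z z) ≤ 1 := fun z hz =>
    Real.sqrt_le_one.2 ((mercerSum_self_le hlam hh hR hu J hz).trans (kernel_le_one hlam _ _ _))
  exact (abs_mercerSum_le ev u J x y).trans
    (mul_le_one₀ (h1 x hx) (Real.sqrt_nonneg _) (h1 y hy))

theorem abs_funcH_sub_funcHTrunc_le (hlam : 0 < lam) (hh : 0 < h) (hR : 0 < R) (hd : 1 ≤ d)
    {α : ℝ} (hα : 0 < α) (hu : IsEigendecomposition lam h R ev u) (J : ℕ) {N p : ℕ} (hp : 1 ≤ p)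
    (hpN : p < N) {phi : Fin d → ℝ → ℝ}
    (hphi : ∀ i, ContDiffOn ℝ ((p + 1 : ℕ) : WithTop ℕ∞) (phi i) (Icc (-R) R)) :
    |funcH lam h R phi - funcHTrunc lam R ev u J N phi| ≤
      cLam lam * (d + 1) * (2 * R) ^ (d - 1) *
        (2 * R * Real.exp (lam / h ^ 2 * R ^ 2 * Real.exp α / 2)) * Real.exp (-(α * J / 2)) *
          ∏ i, supNorm R (phi i) +
      d * cLam lam * chebTail R p N phi *
        (maxSupNorm R phi + chebTail R p N phi) ^ (d - 1) * kernel lam h 0 0 *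
          (∑' j, ev j) ^ d := by
  have hc : 0 ≤ cLam lam := (Real.exp_pos _).le
  have h0 : (0 : ℝ) ∈ Icc (-R) R := ⟨by linarith, hR.le⟩
  have i0 : Fin d := ⟨0, hd⟩
  have hphic : ∀ i, Continuous fun x => phi i (clamp R x) := fun i =>
    (hphi i).continuousOn.comp_continuous (continuous_clamp R) (clamp_mem hR)
  have hm : 0 ≤ maxSupNorm R phi := lpNorm_nonneg.trans (supNorm_le_maxSupNorm phi i0)
  have happrox : ∀ i, ∀ x ∈ Icc (-R) R,
      |phi i x - chebSum R (phi i) N x| ≤ chebTail R p N phi := fun i x hx =>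
    (abs_sub_chebSum_le hR hp hpN (hphi i) hx).trans (le_chebTail hpN phi i)
  have hε : 0 ≤ chebTail R p N phi := (abs_nonneg _).trans (happrox i0 0 h0)
  have hchebc : ∀ i, Continuous (chebSum R (phi i) N) := fun i => continuous_chebSum R (phi i) N
  have hKJ := continuous_mercerSum_clamp hR hu J
  have hK := continuous_kernel_clamp lam h R
  set s := lam / h ^ 2 * R ^ 2 * Real.exp α
  -- This is the square root of `2R` times the bound for `ev J`. The index `J` is the first one
  -- omitted, since indexing starts at `0`.
  set δ := 2 * R * Real.exp (s / 2) * Real.exp (-(α * J / 2)) with hδ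
  have hδJ : Real.sqrt (2 * R * ev J) ≤ δ := by
    rw [Real.sqrt_le_iff]
    refine ⟨by positivity, ?_⟩
    have h1 := mul_le_mul_of_nonneg_left (hu.le_exp hlam hh hR hα J)
      (show (0 : ℝ) ≤ 2 * R by positivity)
    refine h1.trans (le_of_eq ?_)
    have h2 : Real.exp s = Real.exp (s / 2) ^ 2 := by rw [← Real.exp_nat_mul]; ring_nf
    have h3 : Real.exp (-(α * J)) = Real.exp (-(α * J / 2)) ^ 2 := by
      rw [← Real.exp_nat_mul]; ring_nf
    rw [hδ, h2, h3]
    ring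
  -- The kernel is replaced while the `phi i` are still exact, so only their own norms appear here.
  have hE1 := abs_integral_chain_sub_kernel_le hR hd (ψ := fun i x => phi i (clamp R x)) (δ := δ)
    (B := fun i => supNorm R (phi i)) hK hKJ
    (fun x y => kernel_comm _ _ _ _) (fun x y => mercerSum_comm _ _ _ _ _)
    (fun x y => by
      rw [abs_of_nonneg (kernel_nonneg _ _ _ _)]; exact kernel_le_one hlam _ _ _)
    (fun x y => abs_mercerSum_le_one hlam hh hR hu J (clamp_mem hR x) (clamp_mem hR y))
    (fun x => by
      rw [integral_clamp fun t => |kernel lam h (clamp R x) t - mercerSum ev u J (clamp R x) t|]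
      exact (integral_abs_kernel_sub_mercerSum_le hlam hh hR hu J (clamp_mem hR x)).trans hδJ)
    hphic (fun i x => abs_le_supNorm hR (hphi i).continuousOn (clamp_mem hR x))
  have hE2 := abs_integral_chain_sub_factor_le (R := R) (ψ := fun i x => phi i (clamp R x))
    (ψ' := fun i x => chebSum R (phi i) N (clamp R x)) (m := maxSupNorm R phi)
    (r := fun x => Real.sqrt (mercerSum ev u J (clamp R x) (clamp R x))) hKJ
    (Real.continuous_sqrt.comp (hKJ.comp (continuous_id.prodMk continuous_id)))
    (fun x y => abs_mercerSum_le ev u J _ _) hphic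
    (fun i => (hchebc i).comp (continuous_clamp R)) hm hε
    (fun i x => (abs_le_supNorm hR (hphi i).continuousOn (clamp_mem hR x)).trans
      (supNorm_le_maxSupNorm phi i))
    (fun i x => happrox i _ (clamp_mem hR x))
  rw [← setIntegral_chain_clamp hR (kernel lam h) phi,
    ← setIntegral_chain_clamp hR (mercerSum ev u J) phi] at hE1
  rw [← setIntegral_chain_clamp hR (mercerSum ev u J) phi,
    ← setIntegral_chain_clamp hR (mercerSum ev u J) fun i => chebSum R (phi i) N] at hE2
  simp only [Real.sq_sqrt (mercerSum_self_nonneg ev u J _), clamp_of_mem h0] at hE2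
  rw [integral_clamp fun x => mercerSum ev u J x x] at hE2
  have hE2' : mercerSum ev u J 0 0 * (∫ x, mercerSum ev u J x x ∂(muI R)) ^ d ≤
      kernel lam h 0 0 * (∑' j, ev j) ^ d :=
    mul_le_mul (mercerSum_self_le hlam hh hR hu J h0)
      (pow_le_pow_left₀ (integral_nonneg fun x => mercerSum_self_nonneg ev u J x)
        (integral_mercerSum_self_le hlam hh hR hu J) _)
      (pow_nonneg (integral_nonneg fun x => mercerSum_self_nonneg ev u J x) _)
      (kernel_nonneg _ _ _ _)
  rw [funcHTrunc_eq_integral hR hu, funcH, ← mul_sub, abs_mul, abs_of_nonneg hc]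
  refine (mul_le_mul_of_nonneg_left ((abs_sub_le _ _ _).trans
    (add_le_add hE1 (hE2.trans (mul_le_mul_of_nonneg_left hE2' (by positivity))))) hc).trans
    (le_of_eq ?_)
  rw [hδ]
  ring

end Main

end

end GinzburgLandau

theorem mainTheorem1 (lam h R : ℝ) (hlam : 0 < lam) (hh : 0 < h) (hR : 0 < R) :
    IsCompactOperator (GinzburgLandau.opH0 lam h R) ∧
    (GinzburgLandau.opH0 lam h R).IsSymmetric ∧
    (GinzburgLandau.opH0 lam h R).IsPositive ∧
    (∃ (ev : ℕ → ℝ) (u : ℕ → ℝ → ℝ), GinzburgLandau.IsEigendecomposition lam h R ev u) ∧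
    ∀ d : ℕ, 1 ≤ d → ∀ α : ℝ, 0 < α → ∃ M : ℝ, 0 < M ∧
      ∀ (ev : ℕ → ℝ) (u : ℕ → ℝ → ℝ), GinzburgLandau.IsEigendecomposition lam h R ev u →
        Summable ev ∧
        ∀ (J N p : ℕ), 1 ≤ J → 1 ≤ p → p < N →
        ∀ phi : Fin d → ℝ → ℝ,
          (∀ i, ContDiffOn ℝ ((p + 1 : ℕ) : WithTop ℕ∞) (phi i) (Set.Icc (-R) R)) →
          (∀ i, ∀ x ∈ Set.Icc (-R) R,
            HasSum (fun n => GinzburgLandau.chebCoeff R (phi i) n * GinzburgLandau.chebT R n x)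
              (phi i x)) ∧
          |GinzburgLandau.funcH lam h R phi - GinzburgLandau.funcHTrunc lam R ev u J N phi| ≤
            M * Real.exp (-(α * J / 2)) * ∏ i, GinzburgLandau.supNorm R (phi i) +
            d * GinzburgLandau.cLam lam * GinzburgLandau.chebTail R p N phi *
              (GinzburgLandau.maxSupNorm R phi + GinzburgLandau.chebTail R p N phi) ^ (d - 1) *
              GinzburgLandau.kernel lam h 0 0 * (∑' j, ev j) ^ d ∧
          (1 ≤ GinzburgLandau.maxSupNorm R phi →
            |GinzburgLandau.funcH lam h R phi - GinzburgLandau.funcHTrunc lam R ev u J N phi| ≤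
              M * Real.exp (-(α * J / 2)) * ∏ i, GinzburgLandau.supNorm R (phi i) +
              d * GinzburgLandau.cLam lam * GinzburgLandau.chebTail R p N phi *
                (1 + GinzburgLandau.chebTail R p N phi) ^ (d - 1) *
                GinzburgLandau.kernel lam h 0 0 * (∑' j, ev j) ^ d *
                GinzburgLandau.maxSupNorm R phi ^ (d - 1)) := by
  open GinzburgLandau in
  have hT := hasSum_opH0 hlam hh hR
  have hpos := isPositive_of_hasSum_rankOne hT
  refine ⟨isCompactOperator_of_hasSum_rankOne hT, hpos.isSymmetric, hpos,
    exists_isEigendecomposition hlam hh hR, fun d hd α hα => ?_⟩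
  -- `M` is chosen before the eigendecomposition; the factor `1/2` in the exponent comes from the
  -- square root of the eigenvalue bound.
  refine ⟨cLam lam * (d + 1) * (2 * R) ^ (d - 1) *
    (2 * R * Real.exp (lam / h ^ 2 * R ^ 2 * Real.exp α / 2)), ?_, fun ev u hu =>
    ⟨hu.summable hlam hh hR, fun J N p _ hp hpN phi hphi => ?_⟩⟩
  · have : 0 < cLam lam := Real.exp_pos _
    positivity
  have hmain := abs_funcH_sub_funcHTrunc_le hlam hh hR hd hα hu J hp hpN hphi
  refine ⟨fun i x hx => hasSum_chebCoeff hR hp (hphi i) hx, hmain, fun hmax => hmain.trans ?_⟩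
  have hε : 0 ≤ chebTail R p N phi :=
    (abs_nonneg _).trans ((abs_sub_chebSum_le hR hp hpN (hphi ⟨0, hd⟩)
      (show (0 : ℝ) ∈ Set.Icc (-R) R from ⟨by linarith, hR.le⟩)).trans (le_chebTail hpN phi _))
  have hc : 0 ≤ cLam lam := (Real.exp_pos _).le
  have hK : 0 ≤ kernel lam h 0 0 := kernel_nonneg _ _ _ _
  have hTr : 0 ≤ ∑' j, ev j := tsum_nonneg hu.nonneg
  -- For `m ≥ 1` and `ε ≥ 0`, `m + ε ≤ (1 + ε) m`.
  have h1 : (maxSupNorm R phi + chebTail R p N phi) ^ (d - 1) ≤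
      (1 + chebTail R p N phi) ^ (d - 1) * maxSupNorm R phi ^ (d - 1) := by
    rw [← mul_pow]
    exact pow_le_pow_left₀ (by linarith) (by nlinarith) _
  have h2 := mul_le_mul_of_nonneg_left h1 (show 0 ≤ d * cLam lam * chebTail R p N phi *
    (kernel lam h 0 0 * (∑' j, ev j) ^ d) by positivity)
  linarith
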